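/- Let $f:\mathbb{N}\to\mathbb{C}$ be a function with finite support, where $\mathbb{N}=\{1,2,3,\dots\}$, and write $\|f\|_1=\sum_a|f(a)|$, $\|f\|_2^2=\sum_a|f(a)|^2$, and $(a,b)$ for the greatest common divisor of $a$ and $b$. Let $K>3$ be a real number such that $$\sum_{ab=cd} f(a)f(b)\overline{f(c)f(d)}\le K\|f\|_2^4 .$$ 1. One has $$\Big|\sum_{a,b} f(a)\overline{f(b)}\,\frac{(a,b)^2}{ab}\Big|\le A_1(\log\log K)^{C_1}\|f\|_2^2 ,$$ where $A_1,C_1>0$ are absolute constants. 2. For every $\alpha$ with $1/2<\alpha<1$, $$\Big|\sum_{a,b} f(a)\overline{f(b)}\,\frac{(a,b)^{2\alpha}}{(ab)^{\alpha}}\Big|\le A_2\exp\!\big(C_\alpha(\log K)^{1-\alpha}(\log\log K)^{-\alpha}\big)\|f\|_2^2 ,$$ where $A_2>0$ is an absolute constant and $C_\alpha>0$ depends only on $\alpha$. 3. If $f$ is normalised so that $\|f\|_2\ge 1$, and if $\|f\|_1\ge 3$ and $K\ge\log\|f\|_1$, then $$\Big|\sum_{a,b} f(a)\overline{f(b)}\,\frac{(a,b)}{\sqrt{ab}}\Big|\le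 A_3(\log\|f\|_1)^{-1}\exp\!\big(C_3(\log K\cdot\log\log\|f\|_1)^{1/2}\big)\|f\|_2^2 ,$$ where $A_3,C_3>0$ are absolute constants. -/

import Mathlib

open scoped ComplexConjugate

noncomputable section

/-- `‖f‖₁ = ∑ |f(a)|` for a finitely supported function on the positive integers. -/
def l1Norm (f : ℕ+ →₀ ℂ) : ℝ := ∑ a ∈ f.support, ‖f a‖

/-- `‖f‖₂² = ∑ |f(a)|²` (the square of the `ℓ²` norm). -/
def l2NormSq (f : ℕ+ →₀ ℂ) : ℝ := ∑ a ∈ f.support, ‖f a‖ ^ 2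

/-- The multiplicative energy `∑_{ab=cd} f(a) f(b) conj (f(c) f(d))`. -/
def mulEnergy (f : ℕ+ →₀ ℂ) : ℂ :=
  ∑ a ∈ f.support, ∑ b ∈ f.support, ∑ c ∈ f.support, ∑ d ∈ f.support,
    if a * b = c * d then f a * f b * conj (f c * f d) else 0

/-- The GCD sum `∑_{a,b} f(a) conj (f(b)) (a,b)^{2α} / (ab)^α`. -/
def gcdSum (α : ℝ) (f : ℕ+ →₀ ℂ) : ℂ :=
  ∑ a ∈ f.support, ∑ b ∈ f.support,
    f a * conj (f b) *
      (((Nat.gcd (a : ℕ) (b : ℕ) : ℝ) ^ (2 * α) / ((a : ℝ) * (b : ℝ)) ^ α : ℝ) : ℂ)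

/-- The multiplicative energy is a real number, so that comparing its real part with a real
number is the same as comparing the energy itself. -/
theorem mulEnergy_im (f : ℕ+ →₀ ℂ) : (mulEnergy f).im = 0 := by
  rw [← Complex.conj_eq_iff_im]
  unfold mulEnergy
  simp only [map_sum, apply_ite conj, map_mul, map_zero, Complex.conj_conj]
  simp only [← Finset.sum_product' f.support f.support]
  rw [Finset.sum_comm]
  refine Finset.sum_congr rfl fun x _ => Finset.sum_congr rfl fun y _ => ?_
  by_cases h : x.1 * x.2 = y.1 * y.2
  · rw [if_pos h, if_pos h.symm]; ring
  · rw [if_neg h, if_neg (Ne.symm h)]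

end

/-!
Let `X` be a random completely multiplicative function, with independent values at the primes,
uniform on the unit circle, and put `F = ∑ a, f a * X(a)`. Only the finite set `S` of primes that
divide an element of the support of `f` matters, so `X` lives on the torus `𝕋 ^ S`. Then
`E |F|² = ‖f‖₂²` and `E |F|⁴` is the multiplicative energy of `f`. For `Re s > 0`,
`∑ f(a) conj f(b) (ab / (a, b)²) ^ (-s) = E [Q_s |F|²]`, where `Q_s` is the product over `p ∈ S` of the
Poisson kernels with parameter `p ^ (-s)` at `X(p)` (`integral_torusKernel_mul_norm_sq`).

Hölder's inequality (`integral_mul_le_of_moments`) bounds this mean by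
`(E |Q_s| ^ k) ^ (1 / k) * K ^ (1 / k) * ‖f‖₂²` for every real `k ≥ 2`. By independence the `k`-th
moment factorises over the primes, and for `Re s ≥ 1 / 2` each factor is at most
`exp (k (5 ρ² + min (2 ρ) (2 k ρ²)))` with `ρ = p ^ (-Re s)`
(`integral_norm_cPoisson_rpow_le`). Together this is `norm_gcdDirichlet_le`. What remains is to
choose `k` and to estimate sums over primes.

* For `α = 1`, take `k = 2 log K` and use `∑ p ^ (-s) ≤ log (1 + 1 / (s - 1))`, which follows from
  the Euler product (`sum_primes_rpow_neg_le_log`).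
* For `1 / 2 < α < 1`, take `k = 2 (log K log log K) ^ α` and use Chebyshev's upper bound
  (`exists_sum_primes_rpow_neg_le`, `exists_sum_tail_primes_rpow_neg_le`).
* For `α = 1 / 2`, the bound on the line `Re s = 1 / 2 + 1 / log ‖f‖₁`, which holds uniformly in the
  imaginary part, and the trivial bound `‖f‖₁²` on `Re s = 0` give the claim by the three lines
  theorem (`norm_gcdDirichlet_le_interp`); the factor `(log ‖f‖₁)⁻¹` is absorbed by the exponential
  because `log K ≥ log log ‖f‖₁`.
-/

section

open MeasureTheory AddCircle

/-! ### The Poisson kernel on the circle -/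

/-- The Poisson kernel with a complex parameter `r`, evaluated at a point `z` of the unit circle.
For `‖r‖ < 1` its `n`-th Fourier coefficient is `r ^ |n|`. -/
noncomputable def cPoisson (r z : ℂ) : ℂ := (1 - r ^ 2) / ((1 - r * z) * (1 - r * conj z))

theorem one_sub_mul_ne_zero {r z : ℂ} (hr : ‖r‖ < 1) (hz : ‖z‖ = 1) : 1 - r * z ≠ 0 := by
  intro h
  have : ‖r * z‖ = 1 := by rw [← sub_eq_zero.mp h]; simp
  rw [norm_mul, hz] at this
  linarith

theorem hasSum_cPoisson {r z : ℂ} (hr : ‖r‖ < 1) (hz : ‖z‖ = 1) :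
    HasSum (fun m : ℤ => r ^ m.natAbs * z ^ m) (cPoisson r z) := by
  have hz0 : z ≠ 0 := by rintro rfl; simp at hz
  have hc : conj z = z⁻¹ := (Complex.inv_eq_conj hz).symm
  have hz' : ‖conj z‖ = 1 := by simpa using hz
  have h1 : HasSum (fun n : ℕ => r ^ (n : ℤ).natAbs * z ^ (n : ℤ)) (1 - r * z)⁻¹ := by
    have := hasSum_geometric_of_norm_lt_one (ξ := r * z) (by rw [norm_mul, hz]; linarith)
    refine this.congr_fun ?_
    intro n
    rw [Int.natAbs_natCast, zpow_natCast, mul_pow]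
  have h2 : HasSum (fun n : ℕ => r ^ (-((n : ℤ) + 1)).natAbs * z ^ (-((n : ℤ) + 1)))
      ((r * conj z) * (1 - r * conj z)⁻¹) := by
    have := (hasSum_geometric_of_norm_lt_one (ξ := r * conj z)
      (by rw [norm_mul, hz']; linarith)).mul_left (r * conj z)
    refine this.congr_fun ?_
    intro n
    have e : (-((n : ℤ) + 1)).natAbs = n + 1 := by omega
    rw [e, hc, ← pow_succ', mul_pow, inv_pow, zpow_neg]
    norm_cast
  have h3 := HasSum.of_nat_of_neg_add_one (f := fun m : ℤ => r ^ m.natAbs * z ^ m) h1 h2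
  have n1 := one_sub_mul_ne_zero hr hz
  have n2 := one_sub_mul_ne_zero hr hz'
  have hzz : z * conj z = 1 := by rw [hc, mul_inv_cancel₀ hz0]
  have h4 : cPoisson r z = (1 - r * z)⁻¹ + (r * conj z) * (1 - r * conj z)⁻¹ := by
    rw [cPoisson]
    field_simp
    linear_combination (r ^ 2) * hzz
  rw [h4]
  exact h3

theorem norm_fourier_apply (n : ℤ) (x : UnitAddCircle) : ‖fourier n x‖ = 1 := by
  rw [fourier_apply]; exact Circle.norm_coe _

theorem fourier_one_zpow (n : ℤ) (x : UnitAddCircle) : (fourier 1 x : ℂ) ^ n = fourier n x := by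
  rw [fourier_apply, fourier_apply, one_zsmul, toCircle_zsmul]
  norm_cast

theorem integral_fourier (n : ℤ) :
    ∫ x : UnitAddCircle, (fourier n x : ℂ) ∂haarAddCircle = if n = 0 then 1 else 0 := by
  have := congrFun (fourierCoeff_fourier (T := 1) n) 0
  simp only [fourierCoeff, neg_zero, fourier_zero, one_smul] at this
  rw [this]
  simp [Pi.single_apply, eq_comm]

theorem continuous_cPoisson {r : ℂ} (hr : ‖r‖ < 1) :
    Continuous fun x : UnitAddCircle => cPoisson r (fourier 1 x) := by
  unfold cPoisson
  refine Continuous.div (by fun_prop) ?_ fun x => mul_ne_zero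
    (one_sub_mul_ne_zero hr (norm_fourier_apply _ _))
    (one_sub_mul_ne_zero hr (by rw [RCLike.norm_conj, norm_fourier_apply]))
  have : Continuous fun x : UnitAddCircle => conj (fourier 1 x : ℂ) :=
    Complex.continuous_conj.comp (fourier 1).continuous
  fun_prop

theorem integral_cPoisson_mul_fourier {r : ℂ} (hr : ‖r‖ < 1) (n : ℤ) :
    ∫ x : UnitAddCircle, cPoisson r (fourier 1 x) * fourier n x ∂haarAddCircle
      = r ^ n.natAbs := by
  have key := hasSum_integral_of_summable_integral_norm (μ := haarAddCircle (T := 1))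
    (F := fun (m : ℤ) (x : UnitAddCircle) => r ^ m.natAbs * (fourier (m + n) x : ℂ))
    (fun m => ((fourier (m + n)).continuous.const_smul (r ^ m.natAbs)).integrable_of_hasCompactSupport
      (HasCompactSupport.of_compactSpace _)) (by
      simp only [norm_mul, norm_fourier_apply, mul_one, integral_const, probReal_univ, one_smul]
      have := (hasSum_cPoisson hr (z := 1) (by simp)).summable.norm
      simpa using this)
  have e1 : ∀ x : UnitAddCircle, ∑' m : ℤ, r ^ m.natAbs * (fourier (m + n) x : ℂ)
      = cPoisson r (fourier 1 x) * fourier n x := by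
    intro x
    rw [← (hasSum_cPoisson hr (norm_fourier_apply 1 x)).tsum_eq, ← tsum_mul_right]
    refine tsum_congr fun m => ?_
    rw [fourier_one_zpow, fourier_add, mul_assoc]
  simp only [e1, integral_const_mul, integral_fourier] at key
  rw [← key.tsum_eq, tsum_eq_single (-n)]
  · simp
  · intro m hm
    rw [if_neg (by omega), mul_zero]

theorem norm_inv_one_sub_le {z : ℂ} (hz : ‖z‖ ^ 2 ≤ 1 / 2) :
    ‖(1 - z)⁻¹‖ ≤ Real.exp (z.re + 2 * ‖z‖ ^ 2) := by
  have h34 : ‖z‖ ≤ 3 / 4 := by nlinarith [norm_nonneg z]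
  have hne : (1 - z)⁻¹ ≠ 0 := by
    refine inv_ne_zero fun h => ?_
    rw [← sub_eq_zero.mp h] at h34
    norm_num at h34
  have h1 := Complex.norm_log_one_sub_inv_sub_self_le (z := z) (by linarith)
  have h2 : (1 - ‖z‖)⁻¹ ≤ 4 := by
    rw [inv_le_comm₀ (by linarith) (by norm_num)]; linarith
  have h3 : ((Complex.log (1 - z)⁻¹) - z).re ≤ 2 * ‖z‖ ^ 2 := by
    refine (Complex.re_le_norm _).trans (h1.trans ?_)
    nlinarith [sq_nonneg ‖z‖]
  rw [← Complex.exp_log hne, Complex.norm_exp]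
  apply Real.exp_le_exp.mpr
  rw [Complex.sub_re] at h3
  linarith

/-- The linear part `2 * r.re * z.re` of the exponent is odd in `z`, which makes its contribution to
moments quadratic in `‖r‖`. -/
theorem norm_cPoisson_le {r z : ℂ} (hr : ‖r‖ ^ 2 ≤ 1 / 2) (hz : ‖z‖ = 1) :
    ‖cPoisson r z‖ ≤ Real.exp (5 * ‖r‖ ^ 2 + 2 * r.re * z.re) := by
  have hz' : ‖conj z‖ = 1 := by simpa using hz
  have e1 : ‖r * z‖ = ‖r‖ := by rw [norm_mul, hz, mul_one]
  have e2 : ‖r * conj z‖ = ‖r‖ := by rw [norm_mul, hz', mul_one]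
  have h1 := norm_inv_one_sub_le (z := r * z) (by rwa [e1])
  have h2 := norm_inv_one_sub_le (z := r * conj z) (by rwa [e2])
  rw [e1] at h1
  rw [e2] at h2
  have h3 : ‖1 - r ^ 2‖ ≤ Real.exp (‖r‖ ^ 2) := by
    calc ‖1 - r ^ 2‖ ≤ 1 + ‖r‖ ^ 2 := by
          rw [← norm_pow]; simpa only [norm_one] using norm_sub_le (1 : ℂ) (r ^ 2)
      _ ≤ _ := by linarith [Real.add_one_le_exp (‖r‖ ^ 2)]
  rw [cPoisson, div_eq_mul_inv, mul_inv, norm_mul, norm_mul]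
  calc _ ≤ Real.exp (‖r‖ ^ 2) * (Real.exp ((r * z).re + 2 * ‖r‖ ^ 2) *
        Real.exp ((r * conj z).re + 2 * ‖r‖ ^ 2)) := by gcongr
    _ = _ := by
        rw [← Real.exp_add, ← Real.exp_add]
        congr 1
        simp only [Complex.mul_re, Complex.conj_re, Complex.conj_im]
        ring

/-- The circle is invariant under `z ↦ -z`, so that `exp` may be replaced by `cosh`. -/
theorem integral_exp_mul_re_fourier_le (t : ℝ) :
    ∫ x : UnitAddCircle, Real.exp (t * (fourier 1 x : ℂ).re) ∂haarAddCircle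
      ≤ Real.exp (t ^ 2 / 2) := by
  have hint : ∀ t : ℝ, Integrable (fun x : UnitAddCircle => Real.exp (t * (fourier 1 x : ℂ).re))
      haarAddCircle := fun t => Continuous.integrable_of_hasCompactSupport
    (Real.continuous_exp.comp ((Complex.continuous_re.comp (fourier 1).continuous).const_smul t))
      (HasCompactSupport.of_compactSpace _)
  have hsymm : ∫ x : UnitAddCircle, Real.exp (t * (fourier 1 x : ℂ).re) ∂haarAddCircle
      = ∫ x : UnitAddCircle, Real.exp (-t * (fourier 1 x : ℂ).re) ∂haarAddCircle := by
    rw [← integral_add_right_eq_self _ (((1 : ℝ) / 2 / (1 : ℤ) : ℝ) : UnitAddCircle)]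
    congr 1 with x
    rw [fourier_add_half_inv_index one_ne_zero one_pos]
    simp
  have h2 : ∫ x : UnitAddCircle, Real.exp (t * (fourier 1 x : ℂ).re) ∂haarAddCircle
      = ∫ x : UnitAddCircle, Real.cosh (t * (fourier 1 x : ℂ).re) ∂haarAddCircle := by
    simp only [Real.cosh_eq, ← neg_mul]
    rw [integral_div, integral_add (hint t) (hint (-t)), ← hsymm]
    ring
  rw [h2]
  calc _ ≤ ∫ x : UnitAddCircle, Real.exp (t ^ 2 / 2) ∂haarAddCircle := by
        refine integral_mono_of_nonneg (Filter.Eventually.of_forall fun x => (Real.cosh_pos _).le)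
          (integrable_const _) (Filter.Eventually.of_forall fun x => ?_)
        refine (Real.cosh_le_exp_half_sq _).trans (Real.exp_le_exp.mpr ?_)
        have : |(fourier 1 x : ℂ).re| ≤ 1 :=
          (Complex.abs_re_le_norm _).trans (norm_fourier_apply 1 x).le
        have := (sq_le_one_iff_abs_le_one _).mpr this
        rw [mul_pow]
        nlinarith [sq_nonneg t]
    _ = _ := by simp

/-- The first term of the minimum is the pointwise bound, useful when `k * ‖r‖` is large; the second
one uses the cancellation in the mean and is useful when `k * ‖r‖` is small. -/
theorem integral_norm_cPoisson_rpow_le {r : ℂ} (hr : ‖r‖ ^ 2 ≤ 1 / 2) {k : ℝ} (hk : 0 ≤ k) :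
    ∫ x : UnitAddCircle, ‖cPoisson r (fourier 1 x)‖ ^ k ∂haarAddCircle
      ≤ Real.exp (k * (5 * ‖r‖ ^ 2 + min (2 * ‖r‖) (2 * k * ‖r‖ ^ 2))) := by
  have hre : r.re ^ 2 ≤ ‖r‖ ^ 2 := by
    rw [← sq_abs]; gcongr; exact Complex.abs_re_le_norm r
  have hpt : ∀ x : UnitAddCircle, ‖cPoisson r (fourier 1 x)‖ ^ k
      ≤ Real.exp (k * (5 * ‖r‖ ^ 2)) * Real.exp (2 * k * r.re * (fourier 1 x : ℂ).re) := by
    intro x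
    refine (Real.rpow_le_rpow (norm_nonneg _)
      (norm_cPoisson_le hr (norm_fourier_apply 1 x)) hk).trans_eq ?_
    rw [← Real.exp_mul, ← Real.exp_add]
    congr 1; ring
  rw [mul_add, Real.exp_add]
  have hstep : ∀ g : UnitAddCircle → ℝ, Continuous g →
      (∀ x, ‖cPoisson r (fourier 1 x)‖ ^ k ≤ g x) →
      ∫ x : UnitAddCircle, ‖cPoisson r (fourier 1 x)‖ ^ k ∂haarAddCircle
        ≤ ∫ x, g x ∂haarAddCircle := fun g hg h =>
    integral_mono_of_nonneg (Filter.Eventually.of_forall fun x => by positivity)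
      (hg.integrable_of_hasCompactSupport (HasCompactSupport.of_compactSpace _))
      (Filter.Eventually.of_forall h)
  have hcre : Continuous fun x : UnitAddCircle => (fourier 1 x : ℂ).re :=
    Complex.continuous_re.comp (fourier 1).continuous
  rcases min_choice (2 * ‖r‖) (2 * k * ‖r‖ ^ 2) with h | h <;> rw [h]
  · refine (hstep (fun _ => Real.exp (k * (5 * ‖r‖ ^ 2)) * Real.exp (k * (2 * ‖r‖)))
      continuous_const fun x => (hpt x).trans ?_).trans_eq (by simp)
    refine mul_le_mul_of_nonneg_left (Real.exp_le_exp.mpr ?_) (Real.exp_pos _).le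
    have h1 : r.re * (fourier 1 x : ℂ).re ≤ ‖r‖ * 1 := by
      refine (le_abs_self _).trans ?_
      rw [abs_mul]
      exact mul_le_mul (Complex.abs_re_le_norm r)
        ((Complex.abs_re_le_norm _).trans (norm_fourier_apply 1 x).le) (abs_nonneg _)
        (norm_nonneg _)
    nlinarith [mul_le_mul_of_nonneg_left h1 hk]
  · refine (hstep _ (by fun_prop) hpt).trans ?_
    rw [integral_const_mul]
    gcongr
    refine (integral_exp_mul_re_fourier_le _).trans (Real.exp_le_exp.mpr ?_)
    nlinarith [sq_nonneg k]

/-! ### Random completely multiplicative functions -/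

theorem integrable_of_continuous_of_compactSpace {X E : Type*} [TopologicalSpace X]
    [CompactSpace X] [MeasurableSpace X] [OpensMeasurableSpace X] [NormedAddCommGroup E]
    [SecondCountableTopologyEither X E] {μ : Measure X}
    [IsFiniteMeasureOnCompacts μ] {g : X → E} (hg : Continuous g) : Integrable g μ :=
  hg.integrable_of_hasCompactSupport (HasCompactSupport.of_compactSpace g)

/-- The product of the normalised Haar measures on `𝕋 ^ S`: the coordinates `x p` are independent
and uniform on the circle. -/
noncomputable def torusMeasure (S : Finset ℕ) : Measure (S → UnitAddCircle) :=
  Measure.pi fun _ => haarAddCircle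

instance (S : Finset ℕ) : IsProbabilityMeasure (torusMeasure S) := by
  unfold torusMeasure; infer_instance

/-- The character `∏ p, X_p ^ v_p(m)` of `𝕋 ^ S`: a random completely multiplicative function with
independent uniform unimodular values at the primes of `S`, evaluated at `m`. -/
noncomputable def torusChar (S : Finset ℕ) (m : ℕ) (x : S → UnitAddCircle) : ℂ :=
  ∏ p : S, fourier (m.factorization p : ℤ) (x p)

/-- The product over `p ∈ S` of the Poisson kernels with parameters `r p`. -/
noncomputable def torusKernel (S : Finset ℕ) (r : ℕ → ℂ) (x : S → UnitAddCircle) : ℂ :=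
  ∏ p : S, cPoisson (r p) (fourier 1 (x p))

/-- The random sum `∑ a, f a * X(a)`, for `X` the random completely multiplicative function of
`torusChar`. -/
noncomputable def torusPoly (S : Finset ℕ) (f : ℕ+ →₀ ℂ) (x : S → UnitAddCircle) : ℂ :=
  ∑ a ∈ f.support, f a * torusChar S a x

theorem continuous_torusChar (S : Finset ℕ) (m : ℕ) : Continuous (torusChar S m) := by
  unfold torusChar; fun_prop

theorem continuous_torusKernel (S : Finset ℕ) {r : ℕ → ℂ} (hr : ∀ p ∈ S, ‖r p‖ < 1) :
    Continuous (torusKernel S r) :=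
  continuous_finsetProd _ fun p _ =>
    (continuous_cPoisson (hr p p.2)).comp (continuous_apply p)

theorem continuous_torusPoly (S : Finset ℕ) (f : ℕ+ →₀ ℂ) : Continuous (torusPoly S f) :=
  continuous_finsetSum _ fun a _ => continuous_const.mul (continuous_torusChar S a)

theorem torusChar_mul (S : Finset ℕ) {m n : ℕ} (hm : m ≠ 0) (hn : n ≠ 0)
    (x : S → UnitAddCircle) :
    torusChar S (m * n) x = torusChar S m x * torusChar S n x := by
  unfold torusChar
  rw [← Finset.prod_mul_distrib]
  refine Finset.prod_congr rfl fun p _ => ?_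
  rw [Nat.factorization_mul hm hn, Finsupp.add_apply, Nat.cast_add, fourier_add]

theorem integral_torusKernel_mul_char (S : Finset ℕ) {r : ℕ → ℂ} (hr : ∀ p ∈ S, ‖r p‖ < 1)
    (m n : ℕ) :
    ∫ x, torusKernel S r x * (torusChar S m x * conj (torusChar S n x)) ∂torusMeasure S
      = ∏ p : S, r p ^ ((m.factorization p : ℤ) - n.factorization p).natAbs := by
  have h : ∀ x : S → UnitAddCircle,
      torusKernel S r x * (torusChar S m x * conj (torusChar S n x))
      = ∏ p : S, (cPoisson (r p) (fourier 1 (x p)) *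
          fourier ((m.factorization p : ℤ) - n.factorization p) (x p)) := by
    intro x
    unfold torusKernel torusChar
    rw [map_prod, ← Finset.prod_mul_distrib, ← Finset.prod_mul_distrib]
    refine Finset.prod_congr rfl fun p _ => ?_
    rw [sub_eq_add_neg, fourier_add, fourier_neg]
  simp only [h]
  rw [torusMeasure, integral_fintype_prod_eq_prod
    (f := fun (p : S) (y : UnitAddCircle) => cPoisson (r p) (fourier 1 y) *
          fourier ((m.factorization p : ℤ) - n.factorization p) y)]
  exact Finset.prod_congr rfl fun p _ => integral_cPoisson_mul_fourier (hr p p.2) _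

theorem integral_norm_torusKernel_rpow_le (S : Finset ℕ) {r : ℕ → ℂ}
    (hr : ∀ p ∈ S, ‖r p‖ ^ 2 ≤ 1 / 2) {k : ℝ} (hk : 0 ≤ k) :
    ∫ x, ‖torusKernel S r x‖ ^ k ∂torusMeasure S
      ≤ Real.exp (k * ∑ p ∈ S, (5 * ‖r p‖ ^ 2 + min (2 * ‖r p‖) (2 * k * ‖r p‖ ^ 2))) := by
  have h : ∀ x : S → UnitAddCircle,
      ‖torusKernel S r x‖ ^ k = ∏ p : S, ‖cPoisson (r p) (fourier 1 (x p))‖ ^ k := by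
    intro x
    rw [torusKernel, norm_prod, Real.finsetProd_rpow _ _ fun _ _ => norm_nonneg _]
  simp only [h]
  rw [torusMeasure, integral_fintype_prod_eq_prod
    (f := fun (p : S) (y : UnitAddCircle) => ‖cPoisson (r p) (fourier 1 y)‖ ^ k),
    ← Finset.sum_coe_sort, Finset.mul_sum, Real.exp_sum]
  exact Finset.prod_le_prod (fun p _ => integral_nonneg fun x => by positivity)
    fun p _ => integral_norm_cPoisson_rpow_le (hr p p.2) hk

theorem integral_torusChar_mul_conj {S : Finset ℕ} {m n : ℕ} (hm0 : m ≠ 0) (hn0 : n ≠ 0)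
    (hm : m.primeFactors ⊆ S) (hn : n.primeFactors ⊆ S) :
    ∫ x, torusChar S m x * conj (torusChar S n x) ∂torusMeasure S = if m = n then 1 else 0 := by
  have h := integral_torusKernel_mul_char S (r := 0) (by simp) m n
  have h0 : ∀ x, torusKernel S 0 x = 1 := fun x => by simp [torusKernel, cPoisson]
  simp only [h0, one_mul, Pi.zero_apply] at h
  rw [h]
  split_ifs with hmn
  · simp [hmn]
  · obtain ⟨p, hp⟩ : ∃ p, m.factorization p ≠ n.factorization p := by
      by_contra! hcon
      exact hmn (Nat.eq_of_factorization_eq hm0 hn0 hcon)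
    have hpS : p ∈ S := by
      by_contra hpS
      have h1 : m.factorization p = 0 := Finsupp.notMem_support_iff.mp fun h => hpS (hm h)
      have h2 : n.factorization p = 0 := Finsupp.notMem_support_iff.mp fun h => hpS (hn h)
      exact hp (h1.trans h2.symm)
    refine Finset.prod_eq_zero (Finset.mem_univ ⟨p, hpS⟩) (zero_pow ?_)
    dsimp only
    omega

theorem integral_norm_torusPoly_sq {S : Finset ℕ} {f : ℕ+ →₀ ℂ}
    (hS : ∀ a ∈ f.support, (a : ℕ).primeFactors ⊆ S) :
    ∫ x, ‖torusPoly S f x‖ ^ 2 ∂torusMeasure S = l2NormSq f := by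
  have h : ∀ x, ((‖torusPoly S f x‖ ^ 2 : ℝ) : ℂ) = ∑ a ∈ f.support, ∑ b ∈ f.support,
      f a * conj (f b) * (torusChar S a x * conj (torusChar S b x)) := by
    intro x
    push_cast
    rw [← Complex.mul_conj', torusPoly, map_sum, Finset.sum_mul_sum]
    refine Finset.sum_congr rfl fun a _ => Finset.sum_congr rfl fun b _ => ?_
    rw [map_mul]; ring
  have hc : ∀ a b : ℕ, Continuous fun x => torusChar S a x * conj (torusChar S b x) := fun a b =>
    (continuous_torusChar S a).mul (Complex.continuous_conj.comp (continuous_torusChar S b))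
  apply Complex.ofReal_injective
  rw [← integral_complex_ofReal]
  simp only [h]
  rw [integral_finsetSum _ fun a _ => integrable_of_continuous_of_compactSpace (by fun_prop)]
  rw [l2NormSq, Complex.ofReal_sum]
  refine Finset.sum_congr rfl fun a ha => ?_
  rw [integral_finsetSum _ fun b _ => integrable_of_continuous_of_compactSpace (by fun_prop)]
  rw [Finset.sum_eq_single a]
  · rw [integral_const_mul, integral_torusChar_mul_conj a.ne_zero a.ne_zero (hS a ha) (hS a ha),
      if_pos rfl, mul_one, Complex.mul_conj']
    push_cast; rfl
  · intro b hb hba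
    rw [integral_const_mul, integral_torusChar_mul_conj a.ne_zero b.ne_zero (hS a ha) (hS b hb),
      if_neg fun h => hba (PNat.coe_injective h.symm), mul_zero]
  · exact fun h => absurd ha h

/-- The multiplicative energy is the fourth moment of the random sum. -/
theorem integral_norm_torusPoly_pow_four {S : Finset ℕ} {f : ℕ+ →₀ ℂ}
    (hS : ∀ a ∈ f.support, (a : ℕ).primeFactors ⊆ S) :
    ∫ x, (‖torusPoly S f x‖ ^ 2) ^ 2 ∂torusMeasure S = (mulEnergy f).re := by
  have h : ∀ x, (((‖torusPoly S f x‖ ^ 2) ^ 2 : ℝ) : ℂ) =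
      ∑ a ∈ f.support, ∑ b ∈ f.support, ∑ c ∈ f.support, ∑ d ∈ f.support,
      f a * f b * conj (f c * f d) *
        (torusChar S (a * b : ℕ+) x * conj (torusChar S (c * d : ℕ+) x)) := by
    intro x
    push_cast
    have hF : torusPoly S f x * torusPoly S f x = ∑ a ∈ f.support, ∑ b ∈ f.support,
        f a * f b * torusChar S (a * b : ℕ+) x := by
      rw [torusPoly, Finset.sum_mul_sum]
      refine Finset.sum_congr rfl fun a _ => Finset.sum_congr rfl fun b _ => ?_
      rw [PNat.mul_coe, torusChar_mul S a.ne_zero b.ne_zero]; ring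
    rw [← Complex.mul_conj', mul_pow, sq, sq, ← map_mul, hF]
    simp only [map_sum]
    rw [Finset.sum_mul]
    refine Finset.sum_congr rfl fun a _ => ?_
    rw [Finset.sum_mul]
    refine Finset.sum_congr rfl fun b _ => ?_
    rw [Finset.mul_sum]
    refine Finset.sum_congr rfl fun c _ => ?_
    rw [Finset.mul_sum]
    refine Finset.sum_congr rfl fun d _ => ?_
    simp only [map_mul, PNat.mul_coe]; ring
  have hc : ∀ a b : ℕ, Continuous fun x => torusChar S a x * conj (torusChar S b x) := fun a b =>
    (continuous_torusChar S a).mul (Complex.continuous_conj.comp (continuous_torusChar S b))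
  have hS2 : ∀ a ∈ f.support, ∀ b ∈ f.support, ((a * b : ℕ+) : ℕ).primeFactors ⊆ S := by
    intro a ha b hb
    rw [PNat.mul_coe, Nat.primeFactors_mul a.ne_zero b.ne_zero]
    exact Finset.union_subset (hS a ha) (hS b hb)
  have hre : ((∫ x, (‖torusPoly S f x‖ ^ 2) ^ 2 ∂torusMeasure S : ℝ) : ℂ) = mulEnergy f := by
    rw [← integral_complex_ofReal]
    simp only [h]
    unfold mulEnergy
    rw [integral_finsetSum _ fun a _ => integrable_of_continuous_of_compactSpace (by fun_prop)]
    refine Finset.sum_congr rfl fun a ha => ?_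
    rw [integral_finsetSum _ fun b _ => integrable_of_continuous_of_compactSpace (by fun_prop)]
    refine Finset.sum_congr rfl fun b hb => ?_
    rw [integral_finsetSum _ fun c _ => integrable_of_continuous_of_compactSpace (by fun_prop)]
    refine Finset.sum_congr rfl fun c hcs => ?_
    rw [integral_finsetSum _ fun d _ => integrable_of_continuous_of_compactSpace (by fun_prop)]
    refine Finset.sum_congr rfl fun d hd => ?_
    rw [integral_const_mul, integral_torusChar_mul_conj (PNat.ne_zero _) (PNat.ne_zero _)
      (hS2 a ha b hb) (hS2 c hcs d hd)]
    by_cases hab : a * b = c * d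
    · rw [if_pos hab, if_pos (by rw [hab]), mul_one]
    · rw [if_neg hab, if_neg fun h => hab (PNat.coe_injective h), mul_zero]
  rw [← hre, Complex.ofReal_re]

/-! ### GCD sums as means over the torus -/

/-- The quotient `lcm(a, b) / gcd(a, b)`, an exact division; equivalently `a * b / gcd(a, b) ^ 2`. -/
def lcmDivGcd (a b : ℕ) : ℕ := a.lcm b / a.gcd b

theorem lcmDivGcd_ne_zero {a b : ℕ} (ha : a ≠ 0) (hb : b ≠ 0) : lcmDivGcd a b ≠ 0 :=
  (Nat.div_pos (Nat.le_of_dvd (Nat.lcm_pos (by omega) (by omega))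
    ((Nat.gcd_dvd_left a b).trans (Nat.dvd_lcm_left a b)))
    (Nat.gcd_pos_of_pos_left _ (by omega))).ne'

theorem lcmDivGcd_mul_sq (a b : ℕ) : lcmDivGcd a b * a.gcd b ^ 2 = a * b := by
  rw [lcmDivGcd, sq, ← mul_assoc, Nat.div_mul_cancel
    ((Nat.gcd_dvd_left a b).trans (Nat.dvd_lcm_left a b)), mul_comm, Nat.gcd_mul_lcm]

theorem factorization_lcmDivGcd {a b : ℕ} (ha : a ≠ 0) (hb : b ≠ 0) (p : ℕ) :
    (lcmDivGcd a b).factorization p = ((a.factorization p : ℤ) - b.factorization p).natAbs := by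
  rw [lcmDivGcd, Nat.factorization_div ((Nat.gcd_dvd_left a b).trans (Nat.dvd_lcm_left a b)),
    Nat.factorization_lcm ha hb, Nat.factorization_gcd ha hb]
  simp only [Finsupp.tsub_apply, Finsupp.sup_apply, Finsupp.inf_apply]
  omega

theorem natCast_cpow_eq_prod {n : ℕ} (hn : n ≠ 0) {S : Finset ℕ} (hS : n.primeFactors ⊆ S)
    (s : ℂ) : (n : ℂ) ^ s = ∏ p ∈ S, ((p : ℂ) ^ s) ^ n.factorization p := by
  have h1 : ∀ (p k : ℕ), ((p ^ k : ℕ) : ℂ) ^ s = ((p : ℂ) ^ s) ^ k := by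
    intro p k
    induction k with
    | zero => simp
    | succ k ih => rw [pow_succ, Nat.cast_mul, Complex.natCast_mul_natCast_cpow, ih, pow_succ]
  have h2 : ∀ T : Finset ℕ, ∀ g : ℕ → ℕ,
      ((∏ p ∈ T, g p : ℕ) : ℂ) ^ s = ∏ p ∈ T, (g p : ℂ) ^ s := by
    intro T g
    induction T using Finset.induction_on with
    | empty => simp
    | insert a T ha ih =>
      rw [Finset.prod_insert ha, Finset.prod_insert ha, Nat.cast_mul,
        Complex.natCast_mul_natCast_cpow, ih]
  have h3 : n = ∏ p ∈ S, p ^ n.factorization p := by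
    conv_lhs => rw [← Nat.prod_factorization_pow_eq_self hn]
    exact Finsupp.prod_of_support_subset _ (by simpa using hS) _ fun _ _ => pow_zero _
  conv_lhs => rw [h3, h2]
  exact Finset.prod_congr rfl fun p _ => h1 p _

/-- The GCD sum as a Dirichlet polynomial in a complex exponent `s`. -/
noncomputable def gcdDirichlet (f : ℕ+ →₀ ℂ) (s : ℂ) : ℂ :=
  ∑ a ∈ f.support, ∑ b ∈ f.support, f a * conj (f b) * (lcmDivGcd a b : ℂ) ^ (-s)

theorem gcdSum_eq_gcdDirichlet (α : ℝ) (f : ℕ+ →₀ ℂ) : gcdSum α f = gcdDirichlet f α := by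
  unfold gcdSum gcdDirichlet
  refine Finset.sum_congr rfl fun a _ => Finset.sum_congr rfl fun b _ => ?_
  congr 1
  have hg : (0 : ℝ) < Nat.gcd (a : ℕ) (b : ℕ) := by
    exact_mod_cast Nat.gcd_pos_of_pos_left _ a.pos
  have hn : (0 : ℝ) < lcmDivGcd a b := by
    exact_mod_cast Nat.pos_of_ne_zero (lcmDivGcd_ne_zero a.ne_zero b.ne_zero)
  have h : (a : ℝ) * (b : ℝ) = lcmDivGcd a b * (Nat.gcd (a : ℕ) (b : ℕ) : ℝ) ^ 2 := by
    exact_mod_cast (lcmDivGcd_mul_sq a b).symm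
  have hreal : (Nat.gcd (a : ℕ) (b : ℕ) : ℝ) ^ (2 * α) / ((a : ℝ) * (b : ℝ)) ^ α
      = (lcmDivGcd a b : ℝ) ^ (-α) := by
    have hgα := (Real.rpow_pos_of_pos hg (2 * α)).ne'
    rw [h, Real.mul_rpow hn.le (by positivity), ← Real.rpow_natCast _ 2, ← Real.rpow_mul hg.le,
      Nat.cast_ofNat, Real.rpow_neg hn.le]
    field_simp
  rw [hreal, Complex.ofReal_cpow hn.le]
  simp

/-- The GCD sum is the mean of `|F|²` against a product of Poisson kernels, since
`(lcm(a, b) / gcd(a, b)) ^ (-s)` is the product of the `(p ^ (-s)) ^ |v_p(a) - v_p(b)|`. -/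
theorem integral_torusKernel_mul_norm_sq {S : Finset ℕ} (hSp : ∀ p ∈ S, p.Prime) {f : ℕ+ →₀ ℂ}
    (hS : ∀ a ∈ f.support, (a : ℕ).primeFactors ⊆ S) {s : ℂ} (hs : 0 < s.re) :
    ∫ x, torusKernel S (fun p => (p : ℂ) ^ (-s)) x * ((‖torusPoly S f x‖ ^ 2 : ℝ) : ℂ)
      ∂torusMeasure S = gcdDirichlet f s := by
  have hr : ∀ p ∈ S, ‖(p : ℂ) ^ (-s)‖ < 1 := by
    intro p hp
    rw [Complex.norm_natCast_cpow_of_pos (hSp p hp).pos]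
    exact Real.rpow_lt_one_of_one_lt_of_neg (by exact_mod_cast (hSp p hp).one_lt) (by simpa)
  have h : ∀ x, torusKernel S (fun p => (p : ℂ) ^ (-s)) x * ((‖torusPoly S f x‖ ^ 2 : ℝ) : ℂ)
      = ∑ a ∈ f.support, ∑ b ∈ f.support, f a * conj (f b) *
        (torusKernel S (fun p => (p : ℂ) ^ (-s)) x *
          (torusChar S a x * conj (torusChar S b x))) := by
    intro x
    push_cast
    rw [← Complex.mul_conj', torusPoly, map_sum, Finset.sum_mul_sum, Finset.mul_sum]
    refine Finset.sum_congr rfl fun a _ => ?_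
    rw [Finset.mul_sum]
    refine Finset.sum_congr rfl fun b _ => ?_
    rw [map_mul]; ring
  have hc : ∀ a b : ℕ, Continuous fun x => torusKernel S (fun p => (p : ℂ) ^ (-s)) x *
      (torusChar S a x * conj (torusChar S b x)) := fun a b =>
    (continuous_torusKernel S hr).mul ((continuous_torusChar S a).mul
      (Complex.continuous_conj.comp (continuous_torusChar S b)))
  simp only [h]
  unfold gcdDirichlet
  rw [integral_finsetSum _ fun a _ => integrable_of_continuous_of_compactSpace (by fun_prop)]
  refine Finset.sum_congr rfl fun a ha => ?_
  rw [integral_finsetSum _ fun b _ => integrable_of_continuous_of_compactSpace (by fun_prop)]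
  refine Finset.sum_congr rfl fun b hb => ?_
  rw [integral_const_mul, integral_torusKernel_mul_char S hr]
  congr 1
  have hsub : (lcmDivGcd a b).primeFactors ⊆ S := by
    intro p hp
    have hp' := Nat.prime_of_mem_primeFactors hp
    have : p ∣ a * b := (lcmDivGcd_mul_sq a b) ▸ (Nat.dvd_of_mem_primeFactors hp).mul_right _
    rcases (hp'.dvd_mul).mp this with h | h
    · exact hS a ha (Nat.mem_primeFactors.mpr ⟨hp', h, a.ne_zero⟩)
    · exact hS b hb (Nat.mem_primeFactors.mpr ⟨hp', h, b.ne_zero⟩)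
  rw [natCast_cpow_eq_prod (lcmDivGcd_ne_zero a.ne_zero b.ne_zero) hsub, ← Finset.prod_coe_sort S]
  refine Finset.prod_congr rfl fun p _ => ?_
  rw [factorization_lcmDivGcd a.ne_zero b.ne_zero]

/-! ### The moment bound -/

/-- Hölder's inequality for `q`, `G ^ (1 - 2 / k)` and `(G ^ 2) ^ (1 / k)`, with exponents `k`,
`(1 - 2 / k)⁻¹` and `k`. -/
theorem integral_mul_le_of_moments {X : Type*} [MeasurableSpace X] {μ : Measure X}
    {q G : X → ℝ} (hq : ∀ x, 0 ≤ q x) (hG : ∀ x, 0 ≤ G x) {k K B m : ℝ} (hk : 2 ≤ k)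
    (hK : 0 < K) (hB : 0 < B) (hm : 0 < m)
    (iq : Integrable (fun x => q x ^ k) μ) (iG : Integrable G μ)
    (iG2 : Integrable (fun x => G x ^ 2) μ)
    (h1 : ∫ x, q x ^ k ∂μ ≤ B ^ k) (h2 : ∫ x, G x ∂μ ≤ m) (h3 : ∫ x, G x ^ 2 ∂μ ≤ K * m ^ 2) :
    ∫ x, q x * G x ∂μ ≤ K ^ (1 / k) * B * m := by
  have hk0 : 0 < k := by linarith
  set w := 1 / k with hw
  have hw0 : 0 < w := by positivity
  have hw2 : 0 ≤ 1 - 2 * w := by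
    have : w ≤ 1 / 2 := by rw [hw]; exact one_div_le_one_div_of_le (by norm_num) hk
    linarith
  have hKw : 0 < K ^ w := Real.rpow_pos_of_pos hK _
  -- Weighted arithmetic-geometric means, each of the three functions being normalised to have
  -- mean at most `1`.
  have hpt : ∀ x, q x * G x ≤ K ^ w * B * m *
      (w * (q x ^ k / B ^ k) + (1 - 2 * w) * (G x / m) + w * (G x ^ 2 / (K * m ^ 2))) := by
    intro x
    rcases (hG x).eq_or_lt with h0 | hGx
    · rw [← h0, mul_zero]
      have := hq x
      positivity
    have hg := Real.geom_mean_le_arith_mean3_weighted hw0.le hw2 hw0.le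
      (p₁ := q x ^ k / B ^ k) (p₂ := G x / m) (p₃ := G x ^ 2 / (K * m ^ 2))
      (by have := hq x; positivity) (by positivity) (by positivity) (by ring)
    refine le_trans (le_of_eq ?_) (mul_le_mul_of_nonneg_left hg (by positivity))
    have hkw : k * w = 1 := by rw [hw]; field_simp
    have e1 : (q x ^ k / B ^ k) ^ w = q x / B := by
      rw [← Real.div_rpow (hq x) hB.le, ← Real.rpow_mul (by have := hq x; positivity), hkw,
        Real.rpow_one]
    have e3 : (G x ^ 2 / (K * m ^ 2)) ^ w = (G x / m) ^ (2 * w) / K ^ w := by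
      have : G x ^ 2 / (K * m ^ 2) = (G x / m) ^ (2 : ℝ) / K := by
        rw [Real.rpow_two]; field_simp
      rw [this, Real.div_rpow (by positivity) hK.le, ← Real.rpow_mul (by positivity)]
    have e4 : (G x / m) ^ (1 - 2 * w) * (G x / m) ^ (2 * w) = G x / m := by
      rw [← Real.rpow_add (by positivity)]; simp
    rw [e1, e3, mul_assoc (q x / B), mul_div_assoc', e4]
    field_simp
  calc ∫ x, q x * G x ∂μ ≤ ∫ x, K ^ w * B * m *
      (w * (q x ^ k / B ^ k) + (1 - 2 * w) * (G x / m) + w * (G x ^ 2 / (K * m ^ 2))) ∂μ := by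
        refine integral_mono_of_nonneg (Filter.Eventually.of_forall fun x =>
          mul_nonneg (hq x) (hG x)) ?_ (Filter.Eventually.of_forall hpt)
        exact ((((iq.div_const _).const_mul _).add ((iG.div_const _).const_mul _)).add
          ((iG2.div_const _).const_mul _)).const_mul _
    _ = K ^ w * B * m * (w * ((∫ x, q x ^ k ∂μ) / B ^ k) + (1 - 2 * w) * ((∫ x, G x ∂μ) / m)
          + w * ((∫ x, G x ^ 2 ∂μ) / (K * m ^ 2))) := by
        rw [integral_const_mul, integral_add _ ((iG2.div_const _).const_mul _),
          integral_add ((iq.div_const _).const_mul _) ((iG.div_const _).const_mul _)]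
        · simp only [integral_const_mul, integral_div]
        · exact ((iq.div_const _).const_mul _).add ((iG.div_const _).const_mul _)
    _ ≤ K ^ w * B * m * (w * 1 + (1 - 2 * w) * 1 + w * 1) := by
        have hBk : 0 < B ^ k := Real.rpow_pos_of_pos hB _
        gcongr
        · exact (div_le_one hBk).mpr h1
        · exact (div_le_one hm).mpr h2
        · exact (div_le_one (by positivity)).mpr h3
    _ = K ^ w * B * m := by ring

theorem l2NormSq_nonneg (f : ℕ+ →₀ ℂ) : 0 ≤ l2NormSq f :=
  Finset.sum_nonneg fun _ _ => by positivity

theorem eq_zero_of_l2NormSq_eq_zero {f : ℕ+ →₀ ℂ} (h : l2NormSq f = 0) : f = 0 := by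
  rw [l2NormSq, Finset.sum_eq_zero_iff_of_nonneg fun _ _ => by positivity] at h
  ext a
  by_contra ha
  have := h a (Finsupp.mem_support_iff.mpr ha)
  simp_all

/-- The bound behind all three regimes: the energy controls `|F|⁴`, and `B` controls the `k`-th
moment of the product of Poisson kernels, uniformly in the set of primes and in the imaginary part
of `s`. -/
theorem norm_gcdDirichlet_le {f : ℕ+ →₀ ℂ} {K : ℝ} (hK : 0 < K)
    (hE : (mulEnergy f).re ≤ K * l2NormSq f ^ 2) {k : ℝ} (hk : 2 ≤ k) {s : ℂ}
    (hs : 1 / 2 ≤ s.re) {B : ℝ}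
    (hB : ∀ S : Finset ℕ, (∀ p ∈ S, p.Prime) → ∑ p ∈ S, (5 * ((p : ℝ) ^ (-s.re)) ^ 2 +
      min (2 * (p : ℝ) ^ (-s.re)) (2 * k * ((p : ℝ) ^ (-s.re)) ^ 2)) ≤ B) :
    ‖gcdDirichlet f s‖ ≤ K ^ (1 / k) * Real.exp B * l2NormSq f := by
  rcases (l2NormSq_nonneg f).eq_or_lt with h0 | hm
  · have := eq_zero_of_l2NormSq_eq_zero h0.symm
    subst this
    simp [gcdDirichlet, l2NormSq]
  set S : Finset ℕ := f.support.biUnion fun a => (a : ℕ).primeFactors with hSdef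
  have hSp : ∀ p ∈ S, p.Prime := by
    intro p hp
    obtain ⟨a, _, ha⟩ := Finset.mem_biUnion.mp hp
    exact Nat.prime_of_mem_primeFactors ha
  have hS : ∀ a ∈ f.support, (a : ℕ).primeFactors ⊆ S := fun a ha =>
    Finset.subset_biUnion_of_mem (fun a : ℕ+ => (a : ℕ).primeFactors) ha
  have hn : ∀ p ∈ S, ‖(p : ℂ) ^ (-s)‖ = (p : ℝ) ^ (-s.re) := fun p hp => by
    rw [Complex.norm_natCast_cpow_of_pos (hSp p hp).pos, Complex.neg_re]
  have hr2 : ∀ p ∈ S, ‖(p : ℂ) ^ (-s)‖ ^ 2 ≤ 1 / 2 := by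
    intro p hp
    have hp2 : (2 : ℝ) ≤ p := by exact_mod_cast (hSp p hp).two_le
    rw [hn p hp, ← Real.rpow_natCast, ← Real.rpow_mul (by positivity)]
    calc (p : ℝ) ^ (-s.re * (2 : ℕ)) ≤ (p : ℝ) ^ (-1 : ℝ) :=
          Real.rpow_le_rpow_of_exponent_le (by linarith) (by push_cast; linarith)
      _ ≤ 1 / 2 := by
          rw [Real.rpow_neg_one, ← one_div]
          exact one_div_le_one_div_of_le (by norm_num) hp2
  have hr : ∀ p ∈ S, ‖(p : ℂ) ^ (-s)‖ < 1 := fun p hp => by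
    have := hr2 p hp
    nlinarith [norm_nonneg ((p : ℂ) ^ (-s))]
  have hcK := (continuous_torusKernel S (r := fun p => (p : ℂ) ^ (-s)) hr).norm
  have hcP := (continuous_torusPoly S f).norm
  rw [← integral_torusKernel_mul_norm_sq hSp hS (by linarith)]
  refine (norm_integral_le_integral_norm _).trans ?_
  simp only [norm_mul, Complex.norm_real, Real.norm_eq_abs, abs_pow, abs_norm]
  refine integral_mul_le_of_moments (fun x => norm_nonneg _) (fun x => by positivity) hk hK
    (Real.exp_pos B) hm
    (integrable_of_continuous_of_compactSpace (hcK.rpow_const fun x => Or.inr (by linarith)))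
    (integrable_of_continuous_of_compactSpace (hcP.pow 2))
    (integrable_of_continuous_of_compactSpace ((hcP.pow 2).pow 2)) ?_
    (integral_norm_torusPoly_sq hS).le
    ((integral_norm_torusPoly_pow_four hS).trans_le hE)
  refine (integral_norm_torusKernel_rpow_le S hr2 (by linarith)).trans ?_
  rw [← Real.exp_mul, mul_comm B]
  refine Real.exp_le_exp.mpr (mul_le_mul_of_nonneg_left ?_ (by linarith))
  rw [Finset.sum_congr rfl fun p hp => by rw [hn p hp]]
  exact hB S hSp

end

/-! ### Sums over primes -/

/-- The completely multiplicative function `n ↦ n ^ (-s)` on the natural numbers. -/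
noncomputable def rpowNegHom (s : ℝ) : ℕ →* ℝ where
  toFun n := (n : ℝ) ^ (-s)
  map_one' := by simp
  map_mul' m n := by rw [Nat.cast_mul, Real.mul_rpow (Nat.cast_nonneg _) (Nat.cast_nonneg _)]

theorem sum_range_succ_rpow_neg_le {s : ℝ} (hs : 1 < s) (N : ℕ) :
    ∑ n ∈ Finset.range (N + 2), (n : ℝ) ^ (-s)
      ≤ 1 + (1 - ((N : ℝ) + 1) ^ (1 - s)) / (s - 1) := by
  have hs1 : 0 < s - 1 := by linarith
  induction N with
  | zero => simp [Finset.sum_range_succ, Real.zero_rpow (show -s ≠ 0 by linarith)]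
  | succ N ih =>
    rw [Finset.sum_range_succ]
    set x : ℝ := (N : ℝ) + 1 with hx
    have hx0 : 0 < x := by positivity
    have hcast : ((N + 2 : ℕ) : ℝ) = x + 1 := by push_cast; ring
    have hcast' : (((N + 1 : ℕ) : ℝ) + 1) = x + 1 := by push_cast; ring
    rw [hcast, hcast']
    have hlog : 1 - x / (x + 1) ≤ Real.log ((x + 1) / x) := by
      have := Real.one_sub_inv_le_log_of_pos (show 0 < (x + 1) / x by positivity)
      rwa [inv_div] at this
    -- The tangent line of `t ↦ t ^ (1 - s)` at `x + 1` lies below the graph.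
    have h1 : (1 + (s - 1) * (1 - x / (x + 1))) * (x + 1) ^ (1 - s) ≤ x ^ (1 - s) := by
      have h2 : x ^ (1 - s) = Real.exp ((s - 1) * Real.log ((x + 1) / x)) * (x + 1) ^ (1 - s) := by
        rw [Real.rpow_def_of_pos hx0, Real.rpow_def_of_pos (by positivity), ← Real.exp_add,
          Real.log_div (by positivity) hx0.ne']
        congr 1; ring
      rw [h2]
      gcongr
      refine le_trans ?_ (Real.add_one_le_exp _)
      nlinarith [mul_le_mul_of_nonneg_left hlog hs1.le]
    have h3 : (x + 1) ^ (-s) = (1 - x / (x + 1)) * (x + 1) ^ (1 - s) := by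
      rw [show -s = (1 - s) - 1 by ring, Real.rpow_sub_one (by positivity)]
      field_simp
      ring
    have h4 : (x + 1) ^ (-s) ≤ (x ^ (1 - s) - (x + 1) ^ (1 - s)) / (s - 1) := by
      rw [le_div_iff₀ hs1, h3]
      linarith
    calc _ ≤ 1 + (1 - x ^ (1 - s)) / (s - 1) + (x ^ (1 - s) - (x + 1) ^ (1 - s)) / (s - 1) := by
          gcongr
      _ = _ := by field_simp; ring

theorem sum_range_rpow_neg_le {s : ℝ} (hs : 1 < s) (N : ℕ) :
    ∑ n ∈ Finset.range N, (n : ℝ) ^ (-s) ≤ 1 + 1 / (s - 1) := by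
  have hs1 : 0 < s - 1 := by linarith
  calc _ ≤ ∑ n ∈ Finset.range (N + 2), (n : ℝ) ^ (-s) :=
        Finset.sum_le_sum_of_subset_of_nonneg (Finset.range_mono (by omega))
          fun _ _ _ => by positivity
    _ ≤ _ := sum_range_succ_rpow_neg_le hs N
    _ ≤ _ := by
        gcongr
        have : (0 : ℝ) ≤ ((N : ℝ) + 1) ^ (1 - s) := by positivity
        linarith

/-- The logarithm of the Euler product of `ζ(s)`, combined with `ζ(s) ≤ 1 + 1 / (s - 1)`. -/
theorem sum_primes_rpow_neg_le_log {S : Finset ℕ} (hS : ∀ p ∈ S, p.Prime) {s : ℝ} (hs : 1 < s) :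
    ∑ p ∈ S, (p : ℝ) ^ (-s) ≤ Real.log (1 + 1 / (s - 1)) := by
  have hs1 : 0 < s - 1 := by linarith
  have hsum : Summable (fun n : ℕ => (n : ℝ) ^ (-s)) :=
    summable_of_sum_range_le (fun _ => by positivity) (sum_range_rpow_neg_le hs)
  rw [Real.le_log_iff_exp_le (by positivity), Real.exp_sum]
  have hprod := EulerProduct.prod_filter_prime_geometric_eq_tsum_factoredNumbers
    (f := rpowNegHom s) hsum S
  rw [Finset.filter_true_of_mem hS] at hprod
  calc ∏ p ∈ S, Real.exp ((p : ℝ) ^ (-s)) ≤ ∏ p ∈ S, (1 - rpowNegHom s p)⁻¹ := by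
        refine Finset.prod_le_prod (fun _ _ => (Real.exp_pos _).le) fun p hp => ?_
        have h1 : (p : ℝ) ^ (-s) < 1 :=
          Real.rpow_lt_one_of_one_lt_of_neg (by exact_mod_cast (hS p hp).one_lt) (by linarith)
        have h2 := Real.add_one_le_exp (-(p : ℝ) ^ (-s))
        rw [show rpowNegHom s p = (p : ℝ) ^ (-s) from rfl, le_inv_comm₀ (Real.exp_pos _)
          (by linarith), ← Real.exp_neg]
        linarith
    _ = ∑' m : Nat.factoredNumbers S, rpowNegHom s m := hprod
    _ ≤ ∑' m : ℕ, rpowNegHom s m :=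
        hsum.tsum_subtype_le _ _ fun n => Real.rpow_nonneg (Nat.cast_nonneg n) _
    _ ≤ _ := Real.tsum_le_of_sum_range_le
        (fun n => Real.rpow_nonneg (Nat.cast_nonneg n) _) (sum_range_rpow_neg_le hs)

theorem sum_log_primes_le {S : Finset ℕ} (hS : ∀ p ∈ S, p.Prime) {y : ℝ} (hy : 0 ≤ y)
    (hSy : ∀ p ∈ S, (p : ℝ) ≤ y) : ∑ p ∈ S, Real.log p ≤ Real.log 4 * y := by
  refine le_trans ?_ (Chebyshev.theta_le_log4_mul_x hy)
  rw [Chebyshev.theta]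
  refine Finset.sum_le_sum_of_subset_of_nonneg (fun p hp => ?_) fun p _ _ =>
    Real.log_natCast_nonneg p
  exact Finset.mem_filter.mpr ⟨Finset.mem_Ioc.mpr ⟨(hS p hp).pos, Nat.le_floor (hSy p hp)⟩, hS p hp⟩

theorem sum_rpow_neg_mul_log_block_le {S : Finset ℕ} (hS : ∀ p ∈ S, p.Prime) {y β : ℝ}
    (hy : 0 < y) (hβ : 0 ≤ β) (hlo : ∀ p ∈ S, y ≤ p) (hhi : ∀ p ∈ S, (p : ℝ) ≤ 2 * y) :
    ∑ p ∈ S, (p : ℝ) ^ (-β) * Real.log p ≤ 2 * Real.log 4 * y ^ (1 - β) := by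
  calc ∑ p ∈ S, (p : ℝ) ^ (-β) * Real.log p ≤ ∑ p ∈ S, y ^ (-β) * Real.log p :=
        Finset.sum_le_sum fun p hp => mul_le_mul_of_nonneg_right
          (Real.rpow_le_rpow_of_nonpos hy (hlo p hp) (by linarith)) (Real.log_natCast_nonneg p)
    _ = y ^ (-β) * ∑ p ∈ S, Real.log p := by rw [Finset.mul_sum]
    _ ≤ y ^ (-β) * (Real.log 4 * (2 * y)) := by
        gcongr; exact sum_log_primes_le hS (by linarith) hhi
    _ = _ := by
        rw [show (1 : ℝ) - β = -β + 1 by ring, Real.rpow_add_one hy.ne']; ring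

/-- Chebyshev's bound for `θ` on dyadic blocks, summed downwards from `y`. -/
theorem exists_sum_rpow_neg_mul_log_le {β : ℝ} (hβ0 : 0 ≤ β) (hβ : β < 1) :
    ∃ C : ℝ, 0 < C ∧ ∀ S : Finset ℕ, (∀ p ∈ S, p.Prime) → ∀ y : ℝ, 0 < y →
      (∀ p ∈ S, (p : ℝ) ≤ y) → ∑ p ∈ S, (p : ℝ) ^ (-β) * Real.log p ≤ C * y ^ (1 - β) := by
  have hq : (2 : ℝ)⁻¹ ^ (1 - β) < 1 :=
    Real.rpow_lt_one (by norm_num) (by norm_num) (by linarith)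
  have hl : 0 < Real.log 4 := Real.log_pos (by norm_num)
  set q := (2 : ℝ)⁻¹ ^ (1 - β) with hqdef
  set c := 2 * Real.log 4 * 2 with hc
  have hc0 : 0 < c := by positivity
  have hC0 : 0 < c / (1 - q) := div_pos hc0 (by linarith)
  refine ⟨c / (1 - q), hC0, ?_⟩
  have key : ∀ n : ℕ, ∀ S : Finset ℕ, (∀ p ∈ S, p.Prime) → ∀ y : ℝ, 0 < y → y < 2 ^ n →
      (∀ p ∈ S, (p : ℝ) ≤ y) →
      ∑ p ∈ S, (p : ℝ) ^ (-β) * Real.log p ≤ c / (1 - q) * y ^ (1 - β) := by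
    intro n
    induction n with
    | zero =>
      intro S hS y hy hyn hSy
      have hemp : S = ∅ := Finset.eq_empty_of_forall_notMem fun p hp => by
        have h1 : (2 : ℝ) ≤ p := by exact_mod_cast (hS p hp).two_le
        have h2 := hSy p hp
        norm_num at hyn
        linarith
      rw [hemp, Finset.sum_empty]
      positivity
    | succ n ih =>
      intro S hS y hy hyn hSy
      rw [← Finset.sum_filter_add_sum_filter_not S (fun p : ℕ => (p : ℝ) ≤ y / 2)]
      have h1 := ih (S.filter fun p : ℕ => (p : ℝ) ≤ y / 2)
        (fun p hp => hS p (Finset.mem_filter.mp hp).1) (y / 2) (by linarith)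
        (by rw [pow_succ] at hyn; linarith) (fun p hp => (Finset.mem_filter.mp hp).2)
      have h2 := sum_rpow_neg_mul_log_block_le (S := S.filter fun p : ℕ => ¬ (p : ℝ) ≤ y / 2)
        (y := y / 2) (fun p hp => hS p (Finset.mem_filter.mp hp).1) (by linarith) hβ0
        (fun p hp => (not_le.mp (Finset.mem_filter.mp hp).2).le)
        (fun p hp => by have := hSy p (Finset.mem_filter.mp hp).1; linarith)
      have h3 : (y / 2) ^ (1 - β) = q * y ^ (1 - β) := by
        rw [div_eq_inv_mul, Real.mul_rpow (by norm_num) hy.le]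
      rw [h3] at h1 h2
      have hY : 0 < y ^ (1 - β) := Real.rpow_pos_of_pos hy _
      have hq0 : 0 < q := by positivity
      refine (add_le_add h1 h2).trans ?_
      have h5 : 2 * Real.log 4 * (q * y ^ (1 - β)) ≤ c * y ^ (1 - β) := by
        rw [hc]; nlinarith [mul_pos hl hY]
      have h4 : c / (1 - q) * y ^ (1 - β) = c / (1 - q) * (q * y ^ (1 - β)) + c * y ^ (1 - β) := by
        have : (1 - q) ≠ 0 := by linarith
        field_simp; ring
      rw [h4]
      gcongr
  intro S hS y hy hSy
  obtain ⟨n, hn⟩ := pow_unbounded_of_one_lt y (one_lt_two)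
  exact key n S hS y hy hn hSy

/-- Chebyshev's bound for `θ` on dyadic blocks, summed upwards from `y`. -/
theorem exists_sum_tail_rpow_neg_mul_log_le {β : ℝ} (hβ : 1 < β) :
    ∃ C : ℝ, 0 < C ∧ ∀ S : Finset ℕ, (∀ p ∈ S, p.Prime) → ∀ y : ℝ, 0 < y →
      (∀ p ∈ S, y ≤ p) → ∑ p ∈ S, (p : ℝ) ^ (-β) * Real.log p ≤ C * y ^ (1 - β) := by
  have hq : (2 : ℝ) ^ (1 - β) < 1 :=
    Real.rpow_lt_one_of_one_lt_of_neg (by norm_num) (by linarith)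
  have hl : 0 < Real.log 4 := Real.log_pos (by norm_num)
  set q := (2 : ℝ) ^ (1 - β) with hqdef
  set c := 2 * Real.log 4 with hc
  have hc0 : 0 < c := by positivity
  have hC0 : 0 < c / (1 - q) := div_pos hc0 (by linarith)
  refine ⟨c / (1 - q), hC0, ?_⟩
  have key : ∀ n : ℕ, ∀ S : Finset ℕ, (∀ p ∈ S, p.Prime) → ∀ y : ℝ, 0 < y →
      (∀ p ∈ S, y ≤ p) → (∀ p ∈ S, (p : ℝ) < y * 2 ^ n) →
      ∑ p ∈ S, (p : ℝ) ^ (-β) * Real.log p ≤ c / (1 - q) * y ^ (1 - β) := by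
    intro n
    induction n with
    | zero =>
      intro S hS y hy hlo hhi
      have hemp : S = ∅ := Finset.eq_empty_of_forall_notMem fun p hp => by
        have h1 := hlo p hp
        have h2 := hhi p hp
        simp only [pow_zero, mul_one] at h2
        linarith
      rw [hemp, Finset.sum_empty]
      positivity
    | succ n ih =>
      intro S hS y hy hlo hhi
      rw [← Finset.sum_filter_add_sum_filter_not S (fun p : ℕ => (p : ℝ) ≤ 2 * y)]
      have h2 := ih (S.filter fun p : ℕ => ¬ (p : ℝ) ≤ 2 * y)
        (fun p hp => hS p (Finset.mem_filter.mp hp).1) (2 * y) (by linarith)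
        (fun p hp => (not_le.mp (Finset.mem_filter.mp hp).2).le)
        (fun p hp => by
          have := hhi p (Finset.mem_filter.mp hp).1
          rw [pow_succ] at this; linarith)
      have h1 := sum_rpow_neg_mul_log_block_le (S := S.filter fun p : ℕ => (p : ℝ) ≤ 2 * y)
        (fun p hp => hS p (Finset.mem_filter.mp hp).1) hy (by linarith : (0 : ℝ) ≤ β)
        (fun p hp => hlo p (Finset.mem_filter.mp hp).1) (fun p hp => (Finset.mem_filter.mp hp).2)
      rw [Real.mul_rpow (by norm_num) hy.le] at h2
      refine (add_le_add h1 h2).trans_eq ?_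
      have : (1 - q) ≠ 0 := by linarith
      field_simp; ring
  intro S hS y hy hlo
  obtain ⟨n, hn⟩ := pow_unbounded_of_one_lt (((S.sup id : ℕ) : ℝ) / y) (one_lt_two)
  refine key n S hS y hy hlo fun p hp => ?_
  have h1 : (p : ℝ) ≤ (S.sup id : ℕ) := by exact_mod_cast Finset.le_sup (f := id) hp
  rw [div_lt_iff₀ hy] at hn
  linarith

theorem exists_sum_primes_rpow_neg_le {β : ℝ} (hβ0 : 0 ≤ β) (hβ : β < 1) :
    ∃ C : ℝ, 0 < C ∧ ∀ S : Finset ℕ, (∀ p ∈ S, p.Prime) → ∀ y : ℝ, 1 < y →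
      (∀ p ∈ S, (p : ℝ) ≤ y) → ∑ p ∈ S, (p : ℝ) ^ (-β) ≤ C * (y ^ (1 - β) / Real.log y) := by
  set ε := (1 - β) / 2 with hε
  have hε0 : 0 < ε := by rw [hε]; linarith
  obtain ⟨C, hC, h⟩ := exists_sum_rpow_neg_mul_log_le (β := β + ε) (by linarith)
    (by rw [hε]; linarith)
  have hl2 : 0 < Real.log 2 := Real.log_pos (by norm_num)
  set D := 1 + 1 / (ε * Real.log 2) with hD
  have hD0 : 0 < D := by positivity
  refine ⟨D * C, by positivity, fun S hS y hy hSy => ?_⟩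
  have hly : 0 < Real.log y := Real.log_pos hy
  have hy0 : 0 < y := by linarith
  have hpt : ∀ p ∈ S, (p : ℝ) ^ (-β)
      ≤ D * y ^ ε / Real.log y * ((p : ℝ) ^ (-(β + ε)) * Real.log p) := by
    intro p hp
    have hp2 : (2 : ℝ) ≤ p := by exact_mod_cast (hS p hp).two_le
    have hp0 : (0 : ℝ) < p := by linarith
    have hlp : Real.log 2 ≤ Real.log p := Real.log_le_log (by norm_num) hp2
    have hyp : 1 ≤ y / p := (one_le_div hp0).mpr (hSy p hp)
    have h1 : 1 ≤ (y / p) ^ ε := Real.one_le_rpow hyp hε0.le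
    have h2 : Real.log (y / p) ≤ (y / p) ^ ε / ε := Real.log_le_rpow_div (by positivity) hε0
    have h3 : Real.log y = Real.log p + Real.log (y / p) := by
      rw [Real.log_div hy0.ne' hp0.ne']; ring
    -- `log y` exceeds `log p` by at most the factor `D * (y / p) ^ ε`.
    have h4 : Real.log y ≤ D * (y / p) ^ ε * Real.log p := by
      have h5 : (y / p) ^ ε / ε ≤ 1 / (ε * Real.log 2) * (y / p) ^ ε * Real.log p := by
        calc (y / p) ^ ε / ε = 1 / (ε * Real.log 2) * (y / p) ^ ε * Real.log 2 := by field_simp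
          _ ≤ _ := by gcongr
      have h6 : Real.log p ≤ (y / p) ^ ε * Real.log p :=
        le_mul_of_one_le_left (by linarith) h1
      rw [h3, hD, add_mul, add_mul, one_mul]
      linarith
    have h7 : (y / p) ^ ε = y ^ ε * (p : ℝ) ^ (-ε) := by
      rw [Real.div_rpow hy0.le hp0.le, Real.rpow_neg hp0.le]; rfl
    rw [h7] at h4
    rw [neg_add, Real.rpow_add hp0, div_mul_eq_mul_div, le_div_iff₀ hly]
    calc (p : ℝ) ^ (-β) * Real.log y
        ≤ (p : ℝ) ^ (-β) * (D * (y ^ ε * (p : ℝ) ^ (-ε)) * Real.log p) := by gcongr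
      _ = _ := by ring
  calc ∑ p ∈ S, (p : ℝ) ^ (-β)
      ≤ ∑ p ∈ S, D * y ^ ε / Real.log y * ((p : ℝ) ^ (-(β + ε)) * Real.log p) :=
        Finset.sum_le_sum hpt
    _ = D * y ^ ε / Real.log y * ∑ p ∈ S, (p : ℝ) ^ (-(β + ε)) * Real.log p := by
        rw [Finset.mul_sum]
    _ ≤ D * y ^ ε / Real.log y * (C * y ^ (1 - (β + ε))) := by
        gcongr; exact h S hS y hy0 hSy
    _ = _ := by
        rw [show (1 : ℝ) - β = ε + (1 - (β + ε)) by ring, Real.rpow_add hy0]; ring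

theorem exists_sum_tail_primes_rpow_neg_le {β : ℝ} (hβ : 1 < β) :
    ∃ C : ℝ, 0 < C ∧ ∀ S : Finset ℕ, (∀ p ∈ S, p.Prime) → ∀ y : ℝ, 1 < y →
      (∀ p ∈ S, y ≤ p) → ∑ p ∈ S, (p : ℝ) ^ (-β) ≤ C * (y ^ (1 - β) / Real.log y) := by
  obtain ⟨C, hC, h⟩ := exists_sum_tail_rpow_neg_mul_log_le hβ
  refine ⟨C, hC, fun S hS y hy hlo => ?_⟩
  have hly : 0 < Real.log y := Real.log_pos hy
  rw [mul_div_assoc', le_div_iff₀ hly]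
  refine le_trans ?_ (h S hS y (by linarith) hlo)
  rw [Finset.sum_mul]
  refine Finset.sum_le_sum fun p hp => ?_
  gcongr
  exact hlo p hp

theorem sum_tail_inv_sq_le {S : Finset ℕ} {y : ℝ} (hy : 0 < y) (hlo : ∀ p ∈ S, y < p) :
    ∑ p ∈ S, (p : ℝ) ^ (-2 : ℝ) ≤ 2 / y := by
  have hsub : S ⊆ Finset.Ioo ⌊y⌋₊ (S.sup id + 1) := fun p hp =>
    Finset.mem_Ioo.mpr ⟨(Nat.floor_lt hy.le).mpr (hlo p hp),
      Nat.lt_succ_of_le (Finset.le_sup (f := id) hp)⟩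
  calc ∑ p ∈ S, (p : ℝ) ^ (-2 : ℝ) = ∑ p ∈ S, ((p : ℝ) ^ 2)⁻¹ :=
        Finset.sum_congr rfl fun p _ => by
          rw [Real.rpow_neg (Nat.cast_nonneg p), Real.rpow_two]
    _ ≤ ∑ p ∈ Finset.Ioo ⌊y⌋₊ (S.sup id + 1), ((p : ℝ) ^ 2)⁻¹ :=
        Finset.sum_le_sum_of_subset_of_nonneg hsub fun _ _ _ => by positivity
    _ ≤ 2 / (⌊y⌋₊ + 1) := sum_Ioo_inv_sq_le _ _
    _ ≤ 2 / y := by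
        gcongr
        exact (Nat.lt_floor_add_one y).le

/-! ### The three ranges of the exponent -/

/-- The bound on the left appears in `norm_gcdDirichlet_le`; here the first term of the minimum is
used for `p ≤ y` and the second one for `p > y`. -/
theorem sum_localBound_le (S : Finset ℕ) (σ k y : ℝ) :
    ∑ p ∈ S, (5 * ((p : ℝ) ^ (-σ)) ^ 2 +
      min (2 * (p : ℝ) ^ (-σ)) (2 * k * ((p : ℝ) ^ (-σ)) ^ 2))
    ≤ 5 * ∑ p ∈ S, (p : ℝ) ^ (-(2 * σ)) + 2 * ∑ p ∈ S with ((p : ℕ) : ℝ) ≤ y, (p : ℝ) ^ (-σ)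
      + 2 * k * ∑ p ∈ S with ¬ ((p : ℕ) : ℝ) ≤ y, (p : ℝ) ^ (-(2 * σ)) := by
  have hsq : ∀ p : ℕ, ((p : ℝ) ^ (-σ)) ^ 2 = (p : ℝ) ^ (-(2 * σ)) := fun p => by
    rw [← Real.rpow_natCast, ← Real.rpow_mul (Nat.cast_nonneg p)]
    congr 1; push_cast; ring
  simp only [hsq]
  rw [Finset.sum_add_distrib, ← Finset.mul_sum, add_assoc]
  gcongr
  rw [← Finset.sum_filter_add_sum_filter_not S (fun p : ℕ => (p : ℝ) ≤ y), Finset.mul_sum,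
    Finset.mul_sum]
  gcongr
  · exact min_le_left _ _
  · exact min_le_right _ _

theorem one_lt_log_of_three_le {x : ℝ} (hx : 3 ≤ x) : 1 < Real.log x := by
  rw [Real.lt_log_iff_exp_lt (by linarith)]
  exact lt_of_lt_of_le (Real.exp_one_lt_d9.trans (by norm_num)) hx

theorem loglog_three_pos : 0 < Real.log (Real.log 3) :=
  Real.log_pos (one_lt_log_of_three_le le_rfl)

theorem loglog_three_le {x : ℝ} (hx : 3 ≤ x) :
    Real.log (Real.log 3) ≤ Real.log (Real.log x) :=
  Real.log_le_log (by linarith [one_lt_log_of_three_le le_rfl])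
    (Real.log_le_log (by norm_num) hx)

theorem sum_localBound_one_le {S : Finset ℕ} (hS : ∀ p ∈ S, p.Prime) {k : ℝ} (hk : 1 < k) :
    ∑ p ∈ S, (5 * ((p : ℝ) ^ (-(1 : ℝ))) ^ 2 +
      min (2 * (p : ℝ) ^ (-(1 : ℝ))) (2 * k * ((p : ℝ) ^ (-(1 : ℝ))) ^ 2))
    ≤ 9 + 2 * Real.exp 1 * Real.log (1 + Real.log k) := by
  have hlk : 0 < Real.log k := Real.log_pos hk
  refine (sum_localBound_le S 1 k k).trans ?_
  have h1 : ∑ p ∈ S, (p : ℝ) ^ (-(2 * 1 : ℝ)) ≤ 1 := by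
    refine (sum_primes_rpow_neg_le_log hS (by norm_num)).trans ?_
    have := Real.log_le_sub_one_of_pos (show (0 : ℝ) < 1 + 1 / (2 * 1 - 1) by norm_num)
    norm_num at this ⊢
    linarith
  have h3 : ∑ p ∈ S with ¬ ((p : ℕ) : ℝ) ≤ k, (p : ℝ) ^ (-(2 * 1 : ℝ)) ≤ 2 / k := by
    rw [mul_one]
    exact sum_tail_inv_sq_le (by linarith) fun p hp => not_le.mp (Finset.mem_filter.mp hp).2
  -- On `p ≤ k` the exponents `1` and `1 + 1 / log k` differ by a factor at most `exp 1`.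
  have h2 : ∑ p ∈ S with ((p : ℕ) : ℝ) ≤ k, (p : ℝ) ^ (-(1 : ℝ))
      ≤ Real.exp 1 * Real.log (1 + Real.log k) := by
    calc _ ≤ ∑ p ∈ S with ((p : ℕ) : ℝ) ≤ k,
          Real.exp 1 * (p : ℝ) ^ (-(1 + 1 / Real.log k)) := by
          refine Finset.sum_le_sum fun p hp => ?_
          obtain ⟨hpS, hpk⟩ := Finset.mem_filter.mp hp
          have hp0 : (0 : ℝ) < p := by exact_mod_cast (hS p hpS).pos
          rw [Real.rpow_def_of_pos hp0, Real.rpow_def_of_pos hp0, ← Real.exp_add]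
          apply Real.exp_le_exp.mpr
          have : Real.log p * (1 / Real.log k) ≤ 1 := by
            rw [mul_one_div, div_le_one hlk]
            exact Real.log_le_log hp0 hpk
          linarith
      _ = Real.exp 1 * ∑ p ∈ S with ((p : ℕ) : ℝ) ≤ k, (p : ℝ) ^ (-(1 + 1 / Real.log k)) := by
          rw [Finset.mul_sum]
      _ ≤ _ := by
          gcongr
          refine (sum_primes_rpow_neg_le_log (fun p hp => hS p (Finset.mem_filter.mp hp).1)
            (by have : 0 < 1 / Real.log k := by positivity
                linarith)).trans_eq ?_
          congr 1
          field_simp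
          ring
  have h4 : 2 * k * (2 / k) = 4 := by field_simp; norm_num
  have h5 := mul_le_mul_of_nonneg_left h3 (show 0 ≤ 2 * k by linarith)
  rw [h4] at h5
  linarith

theorem exists_norm_gcdSum_one_le : ∃ A C : ℝ, 0 < A ∧ 0 < C ∧
    ∀ (f : ℕ+ →₀ ℂ) (K : ℝ), 3 < K → (mulEnergy f).re ≤ K * l2NormSq f ^ 2 →
      ‖gcdSum 1 f‖ ≤ A * Real.log (Real.log K) ^ C * l2NormSq f := by
  have hu0 := loglog_three_pos
  set u₀ := Real.log (Real.log 3)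
  set C := 2 * Real.exp 1 with hC
  have hC0 : 0 < C := by positivity
  refine ⟨Real.exp (1 / 2) * Real.exp 9 * (1 + 2 / u₀) ^ C, C, by positivity, hC0,
    fun f K hK hE => ?_⟩
  have hL : 1 < Real.log K := one_lt_log_of_three_le hK.le
  have hu : u₀ ≤ Real.log (Real.log K) := loglog_three_le hK.le
  set L := Real.log K with hLdef
  set u := Real.log L with hudef
  have hlk : Real.log (2 * L) = Real.log 2 + u := Real.log_mul (by norm_num) (by linarith)
  have hlog2 : 0 < Real.log 2 := Real.log_pos (by norm_num)
  have hlog2' : Real.log 2 ≤ 1 := by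
    have := Real.log_le_sub_one_of_pos (show (0 : ℝ) < 2 by norm_num); linarith
  -- With `k` a multiple of `log K`, the factor `K ^ (1 / k)` is bounded.
  have h := norm_gcdDirichlet_le (by linarith) hE (k := 2 * L) (by linarith) (s := ((1 : ℝ) : ℂ))
    (by rw [Complex.ofReal_re]; norm_num)
    (B := 9 + C * Real.log (1 + Real.log (2 * L))) (fun S hS => by
      simpa only [Complex.ofReal_re] using sum_localBound_one_le hS (by linarith))
  rw [gcdSum_eq_gcdDirichlet]
  refine h.trans (mul_le_mul_of_nonneg_right ?_ (l2NormSq_nonneg f))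
  have e1 : K ^ (1 / (2 * L)) = Real.exp (1 / 2) := by
    rw [Real.rpow_def_of_pos (by linarith), ← hLdef]
    congr 1; field_simp
  have hpos : 0 < 1 + (Real.log 2 + u) := by linarith
  rw [e1, hlk, Real.exp_add, mul_comm C, ← Real.rpow_def_of_pos hpos, mul_assoc, mul_assoc,
    ← Real.mul_rpow (by positivity) (by linarith)]
  gcongr
  have : 2 ≤ 2 / u₀ * u := by
    rw [div_mul_eq_mul_div, le_div_iff₀ hu0]; linarith
  linarith

/-- For `log (log K) ≥ 1` the choice `y = log K * log (log K)`, `k = 2 * y ^ α` makes `log K / k` and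
the prime sums over `p ≤ y` and `p > y` all of the same order. -/
theorem exists_norm_gcdSum_le_of_exp_exp_le {α : ℝ} (hα : 1 / 2 < α) (hα1 : α < 1) :
    ∃ C : ℝ, 0 < C ∧ ∀ (f : ℕ+ →₀ ℂ) (K : ℝ), Real.exp (Real.exp 1) ≤ K →
      (mulEnergy f).re ≤ K * l2NormSq f ^ 2 →
      ‖gcdSum α f‖ ≤ Real.exp (C * (Real.log K ^ (1 - α) * Real.log (Real.log K) ^ (-α))) *
        l2NormSq f := by
  obtain ⟨C₁, hC₁, h₁⟩ := exists_sum_primes_rpow_neg_le (β := α) (by linarith) hα1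
  obtain ⟨C₂, hC₂, h₂⟩ := exists_sum_tail_primes_rpow_neg_le (β := 2 * α) (by linarith)
  set c₃ := 5 * Real.log (1 + 1 / (2 * α - 1)) with hc₃
  have hc₃0 : 0 ≤ c₃ := by
    have : 0 < 1 / (2 * α - 1) := one_div_pos.mpr (by linarith)
    exact mul_nonneg (by norm_num) (Real.log_nonneg (by linarith))
  have hα' : 0 < 1 - α := by linarith
  refine ⟨1 / 2 + (c₃ / (1 - α) + 2 * C₁ + 4 * C₂), by positivity, fun f K hK hE => ?_⟩
  have hK0 : 0 < K := (Real.exp_pos _).trans_le hK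
  have hL : Real.exp 1 ≤ Real.log K := (Real.le_log_iff_exp_le hK0).mpr hK
  set L := Real.log K with hLdef
  have hL0 : 0 < L := (Real.exp_pos _).trans_le hL
  have hu : 1 ≤ Real.log L := (Real.le_log_iff_exp_le hL0).mpr hL
  set u := Real.log L with hudef
  have hu0 : 0 < u := by linarith
  have hLu : L = Real.exp u := (Real.exp_log hL0).symm
  have hL2 : 2 ≤ L := by have := Real.add_one_le_exp u; linarith
  set E := L ^ (1 - α) * u ^ (-α) with hEdef
  have hE0 : 0 < E := by positivity
  have hE1 : 1 ≤ E / (1 - α) := by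
    have e1 : u ^ α ≤ u := by
      conv_rhs => rw [← Real.rpow_one u]
      exact Real.rpow_le_rpow_of_exponent_le hu hα1.le
    have e2 : L ^ (1 - α) = Real.exp (u * (1 - α)) := by rw [hLu, Real.exp_mul]
    have e3 := Real.add_one_le_exp (u * (1 - α))
    rw [le_div_iff₀ hα', hEdef, e2, Real.rpow_neg hu0.le, ← div_eq_mul_inv,
      le_div_iff₀ (by positivity)]
    nlinarith
  set y := L * u with hy
  have hy1 : 1 < y := by nlinarith
  have hy0 : 0 < y := by linarith
  have hly : u ≤ Real.log y := by
    rw [hy, Real.log_mul hL0.ne' hu0.ne']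
    have := Real.log_nonneg hu
    linarith
  have hyE : y ^ (1 - α) / Real.log y ≤ E := by
    calc y ^ (1 - α) / Real.log y ≤ y ^ (1 - α) / u := by gcongr
      _ = E := by
        rw [hy, Real.mul_rpow hL0.le hu0.le, hEdef, mul_div_assoc, ← Real.rpow_sub_one hu0.ne']
        congr 2; ring
  have hyα : 1 ≤ y ^ α := Real.one_le_rpow hy1.le (by linarith)
  have h := norm_gcdDirichlet_le hK0 hE (k := 2 * y ^ α) (by linarith) (s := (α : ℂ))
    (by rw [Complex.ofReal_re]; linarith)
    (B := c₃ + 2 * (C₁ * E) + 4 * (C₂ * E)) (fun S hS => by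
      rw [Complex.ofReal_re]
      refine (sum_localBound_le S α (2 * y ^ α) y).trans ?_
      have b3 := sum_primes_rpow_neg_le_log hS (s := 2 * α) (by linarith)
      have b1 := h₁ (S.filter fun p : ℕ => (p : ℝ) ≤ y)
        (fun p hp => hS p (Finset.mem_filter.mp hp).1) y hy1
        (fun p hp => (Finset.mem_filter.mp hp).2)
      have b2 := h₂ (S.filter fun p : ℕ => ¬ (p : ℝ) ≤ y)
        (fun p hp => hS p (Finset.mem_filter.mp hp).1) y hy1
        (fun p hp => (not_le.mp (Finset.mem_filter.mp hp).2).le)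
      have b1' := b1.trans (mul_le_mul_of_nonneg_left hyE hC₁.le)
      have b2' : y ^ α * ∑ p ∈ S with ¬ ((p : ℕ) : ℝ) ≤ y, (p : ℝ) ^ (-(2 * α)) ≤ C₂ * E := by
        calc _ ≤ y ^ α * (C₂ * (y ^ (1 - 2 * α) / Real.log y)) := by gcongr
          _ = C₂ * (y ^ (1 - α) / Real.log y) := by
            rw [show 1 - α = α + (1 - 2 * α) by ring, Real.rpow_add hy0]; ring
          _ ≤ _ := by gcongr
      linarith)
  rw [gcdSum_eq_gcdDirichlet]
  refine h.trans (mul_le_mul_of_nonneg_right ?_ (l2NormSq_nonneg f))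
  have e1 : L * (1 / (2 * y ^ α)) = 1 / 2 * E := by
    rw [hy, hEdef, Real.mul_rpow hL0.le hu0.le, Real.rpow_neg hu0.le, Real.rpow_sub hL0,
      Real.rpow_one]
    field_simp
  rw [Real.rpow_def_of_pos hK0, ← hLdef, e1, ← Real.exp_add]
  apply Real.exp_le_exp.mpr
  have : c₃ ≤ c₃ / (1 - α) * E := by
    calc c₃ = c₃ * 1 := (mul_one _).symm
      _ ≤ c₃ * (E / (1 - α)) := by gcongr
      _ = _ := by ring
  linarith

theorem exists_norm_gcdSum_le {α : ℝ} (hα : 1 / 2 < α) (hα1 : α < 1) :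
    ∃ C : ℝ, 0 < C ∧ ∀ (f : ℕ+ →₀ ℂ) (K : ℝ), 3 < K →
      (mulEnergy f).re ≤ K * l2NormSq f ^ 2 →
      ‖gcdSum α f‖ ≤ Real.exp (C * (Real.log K ^ (1 - α) * Real.log (Real.log K) ^ (-α))) *
        l2NormSq f := by
  obtain ⟨C, hC, h⟩ := exists_norm_gcdSum_le_of_exp_exp_le hα hα1
  refine ⟨3 * C, by positivity, fun f K hK hE => ?_⟩
  have hL : 1 < Real.log K := one_lt_log_of_three_le hK.le
  have hu : 0 < Real.log (Real.log K) := Real.log_pos hL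
  have hm := l2NormSq_nonneg f
  rcases le_total (Real.exp (Real.exp 1)) K with hK' | hK'
  · refine (h f K hK' hE).trans ?_
    have : 0 ≤ Real.log K ^ (1 - α) * Real.log (Real.log K) ^ (-α) := by positivity
    gcongr
    linarith
  · -- The hypothesis also holds with `exp (exp 1)` in place of `K`.
    refine (h f _ le_rfl (hE.trans (by gcongr))).trans ?_
    have hL' : Real.log K ≤ Real.exp 1 := (Real.log_le_iff_le_exp (by linarith)).mpr hK'
    have hu' : Real.log (Real.log K) ≤ 1 := (Real.log_le_iff_le_exp (by linarith)).mpr hL'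
    have e1 : (1 : ℝ) ≤ Real.log K ^ (1 - α) * Real.log (Real.log K) ^ (-α) :=
      one_le_mul_of_one_le_of_one_le (Real.one_le_rpow hL.le (by linarith))
        (Real.one_le_rpow_of_pos_of_le_one_of_nonpos hu hu' (by linarith))
    have e2 : Real.exp 1 ^ (1 - α) ≤ 3 := by
      rw [← Real.exp_mul, one_mul]
      refine (Real.exp_le_exp.mpr (show 1 - α ≤ 1 by linarith)).trans ?_
      exact Real.exp_one_lt_d9.le.trans (by norm_num)
    rw [Real.log_exp, Real.log_exp, Real.one_rpow, mul_one]
    refine mul_le_mul_of_nonneg_right (Real.exp_le_exp.mpr ?_) hm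
    calc C * Real.exp 1 ^ (1 - α) ≤ C * 3 := by gcongr
      _ = 3 * C * 1 := by ring
      _ ≤ _ := by gcongr

theorem norm_gcdDirichlet_le_l1Norm_sq (f : ℕ+ →₀ ℂ) {s : ℂ} (hs : 0 ≤ s.re) :
    ‖gcdDirichlet f s‖ ≤ l1Norm f ^ 2 := by
  rw [sq, l1Norm, Finset.sum_mul_sum]
  refine (norm_sum_le _ _).trans (Finset.sum_le_sum fun a _ => ?_)
  refine (norm_sum_le _ _).trans (Finset.sum_le_sum fun b _ => ?_)
  have hn := Nat.pos_of_ne_zero (lcmDivGcd_ne_zero a.ne_zero b.ne_zero)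
  rw [norm_mul, norm_mul, RCLike.norm_conj, Complex.norm_natCast_cpow_of_pos hn, Complex.neg_re]
  exact mul_le_of_le_one_right (by positivity)
    (Real.rpow_le_one_of_one_le_of_nonpos (by exact_mod_cast hn) (by linarith))

theorem differentiable_gcdDirichlet (f : ℕ+ →₀ ℂ) : Differentiable ℂ (gcdDirichlet f) := by
  unfold gcdDirichlet
  refine Differentiable.fun_sum fun a _ => Differentiable.fun_sum fun b _ => ?_
  refine Differentiable.const_mul (Differentiable.const_cpow differentiable_neg (Or.inl ?_)) _
  exact_mod_cast lcmDivGcd_ne_zero a.ne_zero b.ne_zero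

open Complex.HadamardThreeLines in
/-- Hadamard's three lines theorem between the trivial bound on `Re s = 0` and a bound on
`Re s = σ`. -/
theorem norm_gcdDirichlet_le_interp (f : ℕ+ →₀ ℂ) {σ b : ℝ} (hσ : 0 < σ)
    (hb : ∀ s : ℂ, s.re = σ → ‖gcdDirichlet f s‖ ≤ b) {s : ℂ} (hs0 : 0 ≤ s.re) (hs : s.re ≤ σ) :
    ‖gcdDirichlet f s‖ ≤ (l1Norm f ^ 2) ^ (1 - s.re / σ) * b ^ (s.re / σ) := by
  have h := norm_le_interp_of_mem_verticalClosedStrip' (f := gcdDirichlet f) (z := s)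
    (a := l1Norm f ^ 2) (b := b) hσ ⟨hs0, hs⟩ (differentiable_gcdDirichlet f).diffContOnCl
    ⟨l1Norm f ^ 2, by
      rintro _ ⟨z, hz, rfl⟩
      exact norm_gcdDirichlet_le_l1Norm_sq f hz.1⟩
    (fun z hz => norm_gcdDirichlet_le_l1Norm_sq f (Eq.ge hz)) (fun z hz => hb z hz)
  simpa using h

/-- The sums over primes diverge on the line `Re s = 1 / 2`, so the moment bound is applied on
`Re s = 1 / 2 + 1 / log ‖f‖₁` and carried back by the three lines theorem, at the cost of a factor
at most `exp 4`. -/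
theorem exists_norm_gcdSum_half_le : ∃ A C : ℝ, 0 < A ∧ 0 < C ∧
    ∀ (f : ℕ+ →₀ ℂ) (K : ℝ), 3 < K → (mulEnergy f).re ≤ K * l2NormSq f ^ 2 →
      1 ≤ l2NormSq f → 3 ≤ l1Norm f → Real.log (l1Norm f) ≤ K →
      ‖gcdSum (1 / 2) f‖ ≤ A * (Real.log (l1Norm f))⁻¹ *
        Real.exp (C * (Real.log K * Real.log (Real.log (l1Norm f))) ^ (1 / 2 : ℝ)) *
        l2NormSq f := by
  have hu0 := loglog_three_pos
  set u₀ := Real.log (Real.log 3)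
  have hlog2 : 0 < Real.log 2 := Real.log_pos (by norm_num)
  set D := 1 + Real.log 2 / u₀ with hD
  have hD0 : 0 < D := by positivity
  refine ⟨Real.exp 4, 10 * D + 1 / 2 + 1, Real.exp_pos _, by positivity,
    fun f K hK hE hm hN hNK => ?_⟩
  have hN0 : 0 < l1Norm f := by linarith
  have hl : 1 < Real.log (l1Norm f) := one_lt_log_of_three_le hN
  have hv : u₀ ≤ Real.log (Real.log (l1Norm f)) := loglog_three_le hN
  set l := Real.log (l1Norm f) with hldef
  set v := Real.log l with hvdef
  have hv0 : 0 < v := by linarith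
  have hK0 : 0 < K := by linarith
  have hLv : v ≤ Real.log K := Real.log_le_log (by linarith) hNK
  set L := Real.log K with hLdef
  rw [← Real.sqrt_eq_rpow]
  set w := Real.sqrt (L * v) with hw
  have hvw : v ≤ w := Real.le_sqrt_of_sq_le (by nlinarith)
  have hw0 : 0 < w := by linarith
  have hw2 : w * w = L * v := Real.mul_self_sqrt (by nlinarith)
  -- `k = 2 * √(L / v)` balances `log K / k` against `k * v`.
  set k := 2 * w / v with hk
  have hk2 : 2 ≤ k := by rw [hk, le_div_iff₀ hv0]; linarith
  have hlogl : Real.log (1 + 1 / (2 * (1 / 2 + 1 / l) - 1)) ≤ D * v := by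
    calc _ ≤ Real.log (2 * l) := by
          have e : 2 * (1 / 2 + 1 / l) - 1 = 2 / l := by ring
          rw [e, one_div_div]
          exact Real.log_le_log (by positivity) (by linarith)
      _ = Real.log 2 + v := Real.log_mul (by norm_num) (by linarith)
      _ ≤ _ := by
          rw [hD, add_mul, one_mul, add_comm]
          gcongr
          rw [div_mul_eq_mul_div, le_div_iff₀ hu0]
          gcongr
  have hσ : 1 / 2 < 1 / 2 + 1 / l := by
    have : 0 < 1 / l := by positivity
    linarith
  set σ := 1 / 2 + 1 / l with hσdef
  have hline : ∀ s : ℂ, s.re = σ → ‖gcdDirichlet f s‖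
      ≤ Real.exp ((10 * D + 1 / 2) * w) * l2NormSq f := by
    intro s hs
    have h := norm_gcdDirichlet_le hK0 hE (k := k) hk2 (s := s) (by rw [hs]; exact hσ.le)
      (B := 10 * D * w) (fun S hS => by
        rw [hs]
        have b1 := sum_localBound_le S σ k 0
        have b2 := (sum_primes_rpow_neg_le_log hS (s := 2 * σ) (by linarith)).trans hlogl
        have hemp : S.filter (fun p : ℕ => (p : ℝ) ≤ 0) = ∅ :=
          Finset.filter_false_of_mem fun p hp => by
            have : (0 : ℝ) < p := by exact_mod_cast (hS p hp).pos
            exact not_le.mpr this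
        have hfull : S.filter (fun p : ℕ => ¬ (p : ℝ) ≤ 0) = S :=
          Finset.filter_true_of_mem fun p hp => by
            have : (0 : ℝ) < p := by exact_mod_cast (hS p hp).pos
            exact not_le.mpr this
        rw [hemp, hfull, Finset.sum_empty, mul_zero, add_zero, ← add_mul] at b1
        refine b1.trans ?_
        calc _ ≤ (5 + 2 * k) * (D * v) := by gcongr
          _ ≤ 5 * k * (D * v) := by gcongr; linarith
          _ = 10 * D * w := by rw [hk]; field_simp; norm_num)
    refine h.trans_eq ?_
    have e1 : L * (1 / k) = 1 / 2 * w := by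
      rw [hk]; field_simp; linarith
    rw [Real.rpow_def_of_pos hK0, ← hLdef, e1, ← Real.exp_add]
    congr 2; ring
  have hσ0 : 0 < σ := by linarith
  have hre : (((1 / 2 : ℝ) : ℂ)).re = 1 / 2 := Complex.ofReal_re _
  have hinterp := norm_gcdDirichlet_le_interp f hσ0 hline (s := ((1 / 2 : ℝ) : ℂ))
    (by rw [hre]; norm_num) (by rw [hre]; exact hσ.le)
  rw [hre] at hinterp
  rw [gcdSum_eq_gcdDirichlet]
  refine hinterp.trans ?_
  have hθ : 1 / 2 / σ ≤ 1 := (div_le_one hσ0).mpr hσ.le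
  have hθ' : 1 - 1 / 2 / σ ≤ 2 / l := by
    have e : 1 - 1 / 2 / σ = 1 / l / σ := by
      rw [one_sub_div hσ0.ne', hσdef]; congr 1; ring
    rw [e, div_le_iff₀ hσ0, div_mul_eq_mul_div]
    gcongr
    linarith
  have hM1 : 1 ≤ Real.exp ((10 * D + 1 / 2) * w) * l2NormSq f :=
    one_le_mul_of_one_le_of_one_le (Real.one_le_exp (by positivity)) hm
  have f1 : (l1Norm f ^ 2) ^ (1 - 1 / 2 / σ) ≤ Real.exp 4 := by
    rw [Real.rpow_def_of_pos (by positivity), Real.log_pow, ← hldef]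
    apply Real.exp_le_exp.mpr
    push_cast
    calc 2 * l * (1 - 1 / 2 / σ) ≤ 2 * l * (2 / l) := by gcongr
      _ = 4 := by field_simp; norm_num
  have f2 : (Real.exp ((10 * D + 1 / 2) * w) * l2NormSq f) ^ (1 / 2 / σ)
      ≤ Real.exp ((10 * D + 1 / 2) * w) * l2NormSq f :=
    Real.rpow_le_self_of_one_le hM1 hθ
  -- The factor `(log ‖f‖₁)⁻¹` costs only `exp v ≤ exp w`.
  have f3 : Real.exp ((10 * D + 1 / 2) * w) ≤ l⁻¹ * Real.exp ((10 * D + 1 / 2 + 1) * w) := by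
    have hl' : l⁻¹ = Real.exp (-v) := by rw [Real.exp_neg, hvdef, Real.exp_log (by linarith)]
    rw [hl', ← Real.exp_add]
    apply Real.exp_le_exp.mpr
    linarith
  calc _ ≤ Real.exp 4 * (Real.exp ((10 * D + 1 / 2) * w) * l2NormSq f) := by gcongr
    _ ≤ Real.exp 4 * ((l⁻¹ * Real.exp ((10 * D + 1 / 2 + 1) * w)) * l2NormSq f) := by
        gcongr
    _ = _ := by ring

theorem mainTheorem1 :
    -- the case `α = 1`
    (∃ A C : ℝ, 0 < A ∧ 0 < C ∧
      ∀ (f : ℕ+ →₀ ℂ) (K : ℝ), 3 < K →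
        (mulEnergy f).re ≤ K * l2NormSq f ^ 2 →
        ‖gcdSum 1 f‖ ≤ A * Real.log (Real.log K) ^ C * l2NormSq f) ∧
    -- the case `1/2 < α < 1`
    (∃ A : ℝ, 0 < A ∧ ∀ α : ℝ, 1 / 2 < α → α < 1 → ∃ C : ℝ, 0 < C ∧
      ∀ (f : ℕ+ →₀ ℂ) (K : ℝ), 3 < K →
        (mulEnergy f).re ≤ K * l2NormSq f ^ 2 →
        ‖gcdSum α f‖ ≤
          A * Real.exp (C * (Real.log K ^ (1 - α) * Real.log (Real.log K) ^ (-α))) *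
            l2NormSq f) ∧
    -- the case `α = 1/2`
    (∃ A C : ℝ, 0 < A ∧ 0 < C ∧
      ∀ (f : ℕ+ →₀ ℂ) (K : ℝ), 3 < K →
        (mulEnergy f).re ≤ K * l2NormSq f ^ 2 →
        1 ≤ l2NormSq f → 3 ≤ l1Norm f → Real.log (l1Norm f) ≤ K →
        ‖gcdSum (1 / 2) f‖ ≤
          A * (Real.log (l1Norm f))⁻¹ *
            Real.exp (C * (Real.log K * Real.log (Real.log (l1Norm f))) ^ (1 / 2 : ℝ)) *
            l2NormSq f) := by
  refine ⟨exists_norm_gcdSum_one_le, ⟨1, one_pos, fun α hα hα1 => ?_⟩, exists_norm_gcdSum_half_le⟩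
  obtain ⟨C, hC, h⟩ := exists_norm_gcdSum_le hα hα1
  exact ⟨C, hC, fun f K hK hE => by simpa only [one_mul] using h f K hK hE⟩
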